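/- Setting. Let $G$ be a countable set with symmetric conductances $\omega_{xy}=\omega_{yx}\ge 0$; write $x\sim y$ if $\omega_{xy}>0$. Assume that the resulting graph is connected and that $|\{y:\omega_{xy}>0\}|\le M$ for all $x$. Let $d(\cdot,\cdot)$ be the graph distance, $B(x,R)=\{y: d(x,y)<R\}$, $\pi(x)=\sum_y\omega_{xy}$, and let $\tilde d(x,y)$ be the infimum of $\sum_{i<m}(1\wedge\omega_{x_ix_{i+1}}^{-1/2})$ over paths $x=x_0\sim x_1\sim\dots\sim x_m=y$, with balls $\tilde B(x,R)=\{y:\tilde d(x,y)<R\}$. Fix either $\theta=\pi$ (constant speed random walk, CSRW) or $\theta\equiv 1$ (variable speed random walk, VSRW), put $\theta(A)=\sum_{x\in A}\theta(x)$, and let $X$ be the continuous time Markov chain on $G$ that jumps from $x$ to $y$ with probability $\omega_{xy}/\pi(x)$ after an exponential holding time of mean $1$ (CSRW) or $\pi(x)^{-1}$ (VSRW). Let $$\mathcal L_\theta f(x)=\frac1{\theta(x)}\sum_y(f(y)-f(x))\,\omega_{xy},\qquad p_t(x,y)=\frac{P^x(X_t=y)}{\theta(y)},\qquad \tau_A=\inf\{t\ge0:X_t\notin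 A\}.$$ Assumption 1.1. Let $d>0$ be a number (the dimension), $x_0\in G$ a distinguished point, and $\delta,c_1,\dots,c_5,C_E,\kappa>0$ constants; there are thresholds $T_0,R_0,\dots,R_4\in[1,\infty)$, which may depend on $x_0$ and on the graph, such that (i) $p_t(x,y)\le c_1t^{-d/2}$ for all $t\ge T_0$ and $x,y\in B(x_0,t^{(1+\delta)/2})$; (ii) CSRW: $c_2r^2\le E^x[\tau_{B(x,r)}]$ for all $r\ge R_0$, $x\in B(x_0,r^{1+\delta})$; VSRW: $c_2r^2\le E^x[\tau_{\tilde B(x,r)}]$ for all $r\ge R_0$, $x\in\tilde B(x_0,r^{1+\delta})$; (iii) if $R\ge R_1$ and $h\ge0$ is defined on $B(x_0,R)$ and all neighbours of its points, and $\mathcal L_\theta h=0$ on $B(x_0,R)$, then $\sup_{B(x_0,R/2)}h\le C_E\inf_{B(x_0,R/2)}h$; (iv) $c_3R^d\le\theta(B(x_0,R))\le\sup_{x\in B(x_0,R^{1+\delta})}\theta(B(x,R))\le c_4R^d$ for all $R\ge R_2$; (v) CSRW: $\min_{x\in B(x_0,R)}\pi(x)\ge R^{-\kappa}$ for all $R\ge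 R_3$; VSRW: $\tilde d(x,y)\ge c_5d(x,y)$ whenever $R\ge R_4$, $x\in B(x_0,R)$ and $d(x,y)\ge R$. For $C_*\ge2$ and $R,T>0$ let $Q(x,R,T)=(0,4T]\times B(x,C_*R)$ and $Q_+(x,R,T)=[3T,4T]\times B(x,R)$. A function $u(t,x)$ is caloric on $Q(x,R,T)$ if $\partial_tu(t,y)=\mathcal L_\theta u(t,y)$ for $t\in(0,4T)$ and $y\in B(x,C_*R)$, and $t\mapsto u(t,y)$ is continuous on $(0,4T]$ for $y\in B(x,C_*R)$. Corollary 1.6 (Hölder continuity of caloric functions). There exist $c,\beta>0$ and $C_*\ge2$, depending only on the choice of CSRW or VSRW and on $d$, $M$, $\delta,c_1,\dots,c_5,C_E,\kappa$, such that under Assumption 1.1 there is $R_6\in[1,\infty)$ (which may depend on $x_0$ and on the graph) with the following property. Let $R\ge R_6$, $T'\ge R^2+1$, $R'=\sqrt{T'}$, and let $u$ be nonnegative and caloric on $Q(x_0,R',T')$. Then for all $x_1,x_2\in B(x_0,R)$ and all $t_1,t_2\in[4(T'-R^2),4T']$ with $t_1,t_2\ge3T'$ (that is, $(t_1,x_1),(t_2,x_2)\in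 Q_+(x_0,R',T')$; automatic if $T'\ge4R^2$), $$|u(t_1,x_1)-u(t_2,x_2)|\le c\,\Big(\frac{R}{T'^{1/2}}\Big)^{\beta}\sup_{Q_+(x_0,R',T')}u .$$ -/

import Mathlib

open Set MeasureTheory ProbabilityTheory
open scoped ENNReal NNReal

noncomputable section

/-- A weighted graph on the vertex set `V`: symmetric nonnegative conductances `weight x y`.
Two vertices are neighbours, `x ∼ y`, when `0 < weight x y`. -/
structure WeightedGraph (V : Type*) where
  weight : V → V → ℝ
  weight_symm : ∀ x y, weight x y = weight y x
  weight_nonneg : ∀ x y, 0 ≤ weight x y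

/-- The two continuous time random walks: constant speed (`θ = π`) and variable speed (`θ = ν`). -/
inductive WalkType
  | csrw
  | vsrw

namespace WeightedGraph

variable {V : Type*} (Γ : WeightedGraph V)

/-- The simple graph of the edges `x ∼ y` with `x ≠ y`. -/
def toGraph : SimpleGraph V where
  Adj x y := x ≠ y ∧ 0 < Γ.weight x y
  symm := ⟨fun x y h => ⟨h.1.symm, by rw [Γ.weight_symm]; exact h.2⟩⟩
  loopless := ⟨fun _ h => h.1 rfl⟩

/-- Any two vertices are joined by a path of edges. -/
def IsConnected : Prop := Γ.toGraph.Connected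

/-- Every vertex has at most `M` neighbours. -/
def DegreeLE (M : ℕ) : Prop := ∀ x, {y | 0 < Γ.weight x y}.encard ≤ M

/-- The ball `B(x, R) = {y : d(x, y) < R}` of the graph distance. -/
def ball (x : V) (R : ℝ) : Set V := {y | (Γ.toGraph.dist x y : ℝ) < R}

/-- The points of `A` together with all their neighbours. -/
def closure (A : Set V) : Set V := A ∪ {y | ∃ x ∈ A, 0 < Γ.weight x y}

/-- The metric `d~`: the least total length of a path from `x` to `y`, where an edge `a ∼ b`
has length `1 ∧ (weight a b) ^ (-1/2)`. -/
def chemDist (x y : V) : ℝ :=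
  ⨅ p : Γ.toGraph.Walk x y,
    (p.darts.map fun e => min 1 (Γ.weight e.fst e.snd ^ (-(1 / 2) : ℝ))).sum

/-- The ball `B~(x, R)` of the metric `d~`. -/
def chemBall (x : V) (R : ℝ) : Set V := {y | Γ.chemDist x y < R}

/-- `π(x)`, the sum of the conductances at `x` (a finite sum when degrees are bounded). -/
def cond (x : V) : ℝ := ∑ᶠ y, Γ.weight x y

/-- The reference measure: `θ(x) = π(x)` for the CSRW and `θ(x) = 1` for the VSRW. -/
def theta : WalkType → V → ℝ
  | .csrw, x => Γ.cond x
  | .vsrw, _ => 1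

/-- `θ(A)`, used for finite sets `A` such as balls. -/
def mass (w : WalkType) (A : Set V) : ℝ := ∑ᶠ x ∈ A, Γ.theta w x

/-- The discrete Laplace operator `L_θ`. -/
def laplacian (w : WalkType) (f : V → ℝ) (x : V) : ℝ :=
  1 / Γ.theta w x * ∑ᶠ y, (f y - f x) * Γ.weight x y

/-! ### The continuous time Markov chain -/

open Classical in
/-- The law of a jump from `x`: the vertex `y` has probability `weight x y / π(x)`.
(From a vertex without conductances the walk does not move.) -/
def jumpPMF (x : V) : PMF V :=
  if h : (∑' y, ENNReal.ofReal (Γ.weight x y)) ≠ 0 ∧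
      (∑' y, ENNReal.ofReal (Γ.weight x y)) ≠ ∞ then
    PMF.normalize (fun y => ENNReal.ofReal (Γ.weight x y)) h.1 h.2
  else PMF.pure x

section ChainLaw

variable [Countable V] [MeasurableSpace V] [DiscreteMeasurableSpace V]

/-- The transition kernel of the jump chain. -/
def jumpKernel : Kernel V V := Kernel.ofFunOfCountable fun x => (Γ.jumpPMF x).toMeasure

instance : IsMarkovKernel Γ.jumpKernel :=
  ⟨fun x => by
    change IsProbabilityMeasure (Γ.jumpPMF x).toMeasure
    infer_instance⟩

/-- The jump kernel as a function of the whole past up to the `n`-th jump. -/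
def stepKernel (n : ℕ) : Kernel ((_ : Finset.Iic n) → V) V :=
  Γ.jumpKernel.comap (fun h => h ⟨n, Finset.mem_Iic.2 le_rfl⟩) (measurable_pi_apply _)

instance (n : ℕ) : IsMarkovKernel (Γ.stepKernel n) := by
  unfold stepKernel
  infer_instance

/-- The law of the jump chain `(Y₀, Y₁, …)` with `Y₀ = x`. -/
def jumpLaw (x : V) : Measure (ℕ → V) :=
  Kernel.traj (X := fun _ => V) (fun n => Γ.stepKernel n) 0 (fun _ => x)

/-- The law `P^x`: the jump chain started from `x`, and an independent sequence of independent
exponential variables of mean one. -/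
def walkLaw (x : V) : Measure ((ℕ → V) × (ℕ → ℝ)) :=
  (Γ.jumpLaw x).prod (Measure.infinitePi fun _ : ℕ => expMeasure 1)

end ChainLaw

/-- The mean holding time at `x`: `1` for the CSRW and `π(x)⁻¹` for the VSRW. -/
def meanHolding : WalkType → V → ℝ≥0∞
  | .csrw, _ => 1
  | .vsrw, x => (ENNReal.ofReal (Γ.cond x))⁻¹

/-- The time of the `n`-th jump; the holding time before jump `i + 1` is the `i`-th
exponential variable of mean one, multiplied by the mean holding time at `Yᵢ`. -/
def jumpTime (w : WalkType) (ω : (ℕ → V) × (ℕ → ℝ)) (n : ℕ) : ℝ≥0∞ :=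
  ∑ i ∈ Finset.range n, ENNReal.ofReal (ω.2 i) * Γ.meanHolding w (ω.1 i)

open Classical in
/-- The walk `X_t`: it sits at `Yₙ` from the time of the `n`-th jump until the next jump.
The value `none` is a cemetery state, for times after a possible explosion. -/
def position (w : WalkType) (t : ℝ) (ω : (ℕ → V) × (ℕ → ℝ)) : Option V :=
  if h : ∃ n, Γ.jumpTime w ω n ≤ ENNReal.ofReal t ∧ ENNReal.ofReal t < Γ.jumpTime w ω (n + 1)
  then some (ω.1 (Nat.find h))
  else none

/-- The exit time `τ_A = inf {t ≥ 0 : X_t ∉ A}`. -/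
def exitTime (w : WalkType) (A : Set V) (ω : (ℕ → V) × (ℕ → ℝ)) : ℝ≥0∞ :=
  ⨅ (t : ℝ≥0) (_ : ∀ y ∈ A, Γ.position w t ω ≠ some y), (t : ℝ≥0∞)

section ChainLaw

variable [Countable V] [MeasurableSpace V] [DiscreteMeasurableSpace V]

/-- The heat kernel `p_t(x, y) = P^x(X_t = y) / θ(y)`. -/
def heatKernel (w : WalkType) (t : ℝ) (x y : V) : ℝ :=
  (Γ.walkLaw x).real {ω | Γ.position w t ω = some y} / Γ.theta w y

/-- The mean exit time `E^x[τ_A]`. -/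
def meanExitTime (w : WalkType) (x : V) (A : Set V) : ℝ≥0∞ :=
  ∫⁻ ω, Γ.exitTime w A ω ∂(Γ.walkLaw x)

end ChainLaw

end WeightedGraph

/-- The constants of the standing assumption, all positive: exponents `δ`, `κ`, the constants
`c₁, …, c₅` and the elliptic Harnack constant `C_E`. -/
structure WalkConstants where
  (δ c₁ c₂ C_E c₃ c₄ κ c₅ : ℝ)
  δ_pos : 0 < δ
  c₁_pos : 0 < c₁
  c₂_pos : 0 < c₂
  C_E_pos : 0 < C_E
  c₃_pos : 0 < c₃
  c₄_pos : 0 < c₄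
  κ_pos : 0 < κ
  c₅_pos : 0 < c₅

namespace WeightedGraph

variable {V : Type*} (Γ : WeightedGraph V)

/-- The standing assumption at the distinguished point `x₀`, with dimension `d` and
constants `K`; the thresholds `T₀, R₀, …` may depend on `x₀` and on the graph. -/
structure StandingAssumption [Countable V] [MeasurableSpace V] [DiscreteMeasurableSpace V]
    (w : WalkType) (d : ℝ) (K : WalkConstants) (x₀ : V) : Prop where
  /-- On-diagonal heat kernel upper bound. -/
  heat_upper : ∃ T₀ : ℝ, 1 ≤ T₀ ∧ ∀ t : ℝ, T₀ ≤ t →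
    ∀ x ∈ Γ.ball x₀ (t ^ ((1 + K.δ) / 2)), ∀ y ∈ Γ.ball x₀ (t ^ ((1 + K.δ) / 2)),
      Γ.heatKernel w t x y ≤ K.c₁ * t ^ (-d / 2)
  /-- Exit time lower bound, CSRW case. -/
  exit_csrw : w = .csrw → ∃ R₀ : ℝ, 1 ≤ R₀ ∧ ∀ r : ℝ, R₀ ≤ r →
    ∀ x ∈ Γ.ball x₀ (r ^ (1 + K.δ)),
      ENNReal.ofReal (K.c₂ * r ^ 2) ≤ Γ.meanExitTime w x (Γ.ball x r)
  /-- Exit time lower bound, VSRW case. -/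
  exit_vsrw : w = .vsrw → ∃ R₀ : ℝ, 1 ≤ R₀ ∧ ∀ r : ℝ, R₀ ≤ r →
    ∀ x ∈ Γ.chemBall x₀ (r ^ (1 + K.δ)),
      ENNReal.ofReal (K.c₂ * r ^ 2) ≤ Γ.meanExitTime w x (Γ.chemBall x r)
  /-- Elliptic Harnack inequality on balls around `x₀`. -/
  harnack : ∃ R₁ : ℝ, 1 ≤ R₁ ∧ ∀ R : ℝ, R₁ ≤ R → ∀ h : V → ℝ,
    (∀ x ∈ Γ.closure (Γ.ball x₀ R), 0 ≤ h x) →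
    (∀ x ∈ Γ.ball x₀ R, Γ.laplacian w h x = 0) →
    ∀ x ∈ Γ.ball x₀ (R / 2), ∀ y ∈ Γ.ball x₀ (R / 2), h x ≤ K.C_E * h y
  /-- Volume growth of order `d`. -/
  volume : ∃ R₂ : ℝ, 1 ≤ R₂ ∧ ∀ R : ℝ, R₂ ≤ R →
    K.c₃ * R ^ d ≤ Γ.mass w (Γ.ball x₀ R) ∧
    ∀ x ∈ Γ.ball x₀ (R ^ (1 + K.δ)), Γ.mass w (Γ.ball x R) ≤ K.c₄ * R ^ d
  /-- Polynomial lower bound of `π`, CSRW case. -/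
  cond_csrw : w = .csrw → ∃ R₃ : ℝ, 1 ≤ R₃ ∧ ∀ R : ℝ, R₃ ≤ R →
    ∀ x ∈ Γ.ball x₀ R, R ^ (-K.κ) ≤ Γ.cond x
  /-- Comparison of the two metrics, VSRW case. -/
  dist_vsrw : w = .vsrw → ∃ R₄ : ℝ, 1 ≤ R₄ ∧ ∀ R : ℝ, R₄ ≤ R →
    ∀ x ∈ Γ.ball x₀ R, ∀ y : V, R ≤ (Γ.toGraph.dist x y : ℝ) →
      K.c₅ * (Γ.toGraph.dist x y : ℝ) ≤ Γ.chemDist x y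

/-- The cylinder `Q(x, R, T) = (0, 4T] × B(x, C R)`. -/
def cylinder (C : ℝ) (x : V) (R T : ℝ) : Set (ℝ × V) := Ioc 0 (4 * T) ×ˢ Γ.ball x (C * R)

/-- The cylinder `Q₊(x, R, T) = [3T, 4T] × B(x, R)`. -/
def upperCylinder (x : V) (R T : ℝ) : Set (ℝ × V) := Icc (3 * T) (4 * T) ×ˢ Γ.ball x R

/-- `u` is caloric on `Q(x, R, T)`: it solves the heat equation at times in `(0, 4T)` on
`B(x, C R)` and is continuous in time up to the final time `4T`. -/
structure IsCaloric (w : WalkType) (C : ℝ) (x : V) (R T : ℝ) (u : ℝ → V → ℝ) : Prop where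
  hasDerivAt : ∀ t ∈ Ioo 0 (4 * T), ∀ y ∈ Γ.ball x (C * R),
    HasDerivAt (fun s => u s y) (Γ.laplacian w (u t) y) t
  continuousOn : ∀ y ∈ Γ.ball x (C * R), ContinuousOn (fun s => u s y) (Ioc 0 (4 * T))

end WeightedGraph

end

noncomputable section

/-! ### Semigroups of symmetric sub-Markov generators on a finite set -/

section Semigroup

open Matrix

variable {ι : Type*} [Fintype ι] [DecidableEq ι]

/-- The generator of a (possibly killed) Markov chain on a finite set, reversible with respect
to `θ`. -/
structure IsSubMarkov (K : Matrix ι ι ℝ) (θ : ι → ℝ) : Prop where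
  theta_pos : ∀ i, 0 < θ i
  off_diag : ∀ i j, i ≠ j → 0 ≤ K i j
  row_sum : ∀ i, ∑ j, K i j ≤ 0
  symm : ∀ i j, θ i * K i j = θ j * K j i

/-- The semigroup `exp (t K)`. -/
def semigroup (K : Matrix ι ι ℝ) (t : ℝ) : Matrix ι ι ℝ := NormedSpace.exp (t • K)

theorem semigroup_zero (K : Matrix ι ι ℝ) : semigroup K 0 = 1 := by
  simp [semigroup]

theorem semigroup_add (K : Matrix ι ι ℝ) (s t : ℝ) :
    semigroup K (s + t) = semigroup K s * semigroup K t := by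
  unfold semigroup
  rw [add_smul]
  exact Matrix.exp_add_of_commute _ _ ((Commute.refl K).smul_left s |>.smul_right t)

theorem semigroup_commute (K : Matrix ι ι ℝ) (t : ℝ) :
    semigroup K t * K = K * semigroup K t := by
  have h : Commute K (t • K) := (Commute.refl K).smul_right t
  exact (open scoped Norms.Operator in h.exp_right : Commute K (semigroup K t)).symm.eq

theorem hasDerivAt_semigroup_apply (K : Matrix ι ι ℝ) (t : ℝ) (i j : ι) :
    HasDerivAt (fun s => semigroup K s i j) ((semigroup K t * K) i j) t := by
  have h : open scoped Norms.Operator in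
      HasDerivAt (fun s : ℝ => NormedSpace.exp (s • K)) (NormedSpace.exp (t • K) * K) t :=
    open scoped Norms.Operator in hasDerivAt_exp_smul_const K t
  open scoped Norms.Operator in
  have h2 := ((Matrix.entryLinearMap ℝ ℝ i j).toContinuousLinearMap.hasFDerivAt).comp_hasDerivAt t h
  exact h2

theorem hasDerivAt_semigroup_mulVec (K : Matrix ι ι ℝ) (g : ι → ℝ) (t : ℝ) (i : ι) :
    HasDerivAt (fun s => (semigroup K s *ᵥ g) i) ((semigroup K t *ᵥ (K *ᵥ g)) i) t := by
  have h := HasDerivAt.fun_sum (u := Finset.univ)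
    (fun j _ => (hasDerivAt_semigroup_apply K t i j).mul_const (g j))
  rw [mulVec_mulVec]
  exact h

theorem semigroup_mulVec_comm (K : Matrix ι ι ℝ) (g : ι → ℝ) (t : ℝ) :
    semigroup K t *ᵥ (K *ᵥ g) = K *ᵥ (semigroup K t *ᵥ g) := by
  rw [mulVec_mulVec, mulVec_mulVec, semigroup_commute]

theorem exp_apply_nonneg {A : Matrix ι ι ℝ} (hA : ∀ i j, 0 ≤ A i j) (i j : ι) :
    0 ≤ (NormedSpace.exp A : Matrix ι ι ℝ) i j := by
  have hpow : ∀ n : ℕ, ∀ i j, 0 ≤ (A ^ n) i j := by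
    intro n
    induction n with
    | zero => intro i j; rw [pow_zero, one_apply]; split_ifs <;> norm_num
    | succ n ih =>
      intro i j
      rw [pow_succ, mul_apply]
      exact Finset.sum_nonneg fun k _ => mul_nonneg (ih i k) (hA k j)
  have hs : HasSum (fun n : ℕ => ((n.factorial : ℝ)⁻¹ • A ^ n)) (NormedSpace.exp A) :=
    open scoped Norms.Operator in NormedSpace.exp_series_hasSum_exp' (𝕂 := ℝ) A
  have h2 := (Pi.hasSum.1 (Pi.hasSum.1 hs i)) j
  refine h2.nonneg fun n => ?_
  simp only [Matrix.smul_apply, smul_eq_mul]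
  exact mul_nonneg (by positivity) (hpow n i j)

namespace IsSubMarkov

variable {K : Matrix ι ι ℝ} {θ : ι → ℝ} (hK : IsSubMarkov K θ)
include hK

theorem semigroup_nonneg {t : ℝ} (ht : 0 ≤ t) (i j : ι) : 0 ≤ semigroup K t i j := by
  set c : ℝ := ∑ i, |K i i| with hc
  have hsplit : t • K = t • (K + c • (1 : Matrix ι ι ℝ)) + Matrix.diagonal (fun _ => -(t * c)) := by
    rw [smul_add, smul_smul, Matrix.smul_one_eq_diagonal]
    ext a b
    by_cases hab : a = b
    · subst hab; simp
    · simp [hab]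
  have hcomm : Commute (t • (K + c • (1 : Matrix ι ι ℝ))) (Matrix.diagonal (fun _ : ι => -(t * c))) := by
    rw [← smul_one_eq_diagonal]
    exact (Commute.one_right _).smul_right _
  have hnn : ∀ a b, 0 ≤ (t • (K + c • (1 : Matrix ι ι ℝ))) a b := by
    intro a b
    simp only [Matrix.smul_apply, Matrix.add_apply, smul_eq_mul]
    refine mul_nonneg ht ?_
    by_cases hab : a = b
    · subst hab
      have h1 : |K a a| ≤ c := Finset.single_le_sum (f := fun i => |K i i|)
        (fun i _ => abs_nonneg _) (Finset.mem_univ a)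
      have h2 := neg_abs_le (K a a)
      simp only [one_apply_eq, mul_one]
      linarith
    · simpa [one_apply_ne hab] using hK.off_diag a b hab
  unfold semigroup
  rw [hsplit, Matrix.exp_add_of_commute _ _ hcomm, Matrix.exp_diagonal, mul_diagonal]
  refine mul_nonneg (exp_apply_nonneg hnn i j) ?_
  rw [Pi.coe_exp, ← Real.exp_eq_exp_ℝ]
  exact (Real.exp_pos _).le

theorem mulVec_nonneg {t : ℝ} (ht : 0 ≤ t) {g : ι → ℝ} (hg : ∀ i, 0 ≤ g i) (i : ι) :
    0 ≤ (semigroup K t *ᵥ g) i :=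
  Finset.sum_nonneg fun j _ => mul_nonneg (hK.semigroup_nonneg ht i j) (hg j)

theorem mulVec_mono {t : ℝ} (ht : 0 ≤ t) {g h : ι → ℝ} (hg : ∀ i, g i ≤ h i) (i : ι) :
    (semigroup K t *ᵥ g) i ≤ (semigroup K t *ᵥ h) i :=
  Finset.sum_le_sum fun j _ => mul_le_mul_of_nonneg_left (hg j) (hK.semigroup_nonneg ht i j)

theorem row_sum_le_one {t : ℝ} (ht : 0 ≤ t) (i : ι) : (semigroup K t *ᵥ 1) i ≤ 1 := by
  have hanti : AntitoneOn (fun s => (semigroup K s *ᵥ 1) i) (Ici 0) := by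
    refine antitoneOn_of_deriv_nonpos (convex_Ici 0)
      (fun s _ => (hasDerivAt_semigroup_mulVec K 1 s i).continuousAt.continuousWithinAt)
      (fun s _ => (hasDerivAt_semigroup_mulVec K 1 s i).differentiableAt.differentiableWithinAt)
      fun s hs => ?_
    rw [(hasDerivAt_semigroup_mulVec K 1 s i).deriv]
    have hs' : 0 ≤ s := by
      rw [interior_Ici] at hs
      exact hs.le
    have h := hK.mulVec_mono hs' (g := K *ᵥ 1) (h := 0) (fun a => by
      simpa [mulVec, dotProduct] using hK.row_sum a) i
    simpa using h
  have h := hanti (mem_Ici.2 le_rfl) (mem_Ici.2 ht) ht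
  simpa [semigroup_zero] using h

theorem abs_mulVec_le {t : ℝ} (ht : 0 ≤ t) {g : ι → ℝ} {F : ℝ} (hg : ∀ i, |g i| ≤ F) (i : ι) :
    |(semigroup K t *ᵥ g) i| ≤ F * (semigroup K t *ᵥ 1) i := by
  simp only [mulVec, dotProduct, Pi.one_apply, mul_one, Finset.mul_sum]
  refine (Finset.abs_sum_le_sum_abs _ _).trans (Finset.sum_le_sum fun j _ => ?_)
  rw [abs_mul, abs_of_nonneg (hK.semigroup_nonneg ht i j), mul_comm]
  exact mul_le_mul_of_nonneg_right (hg j) (hK.semigroup_nonneg ht i j)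

theorem semigroup_symm (t : ℝ) (i j : ι) : θ i * semigroup K t i j = θ j * semigroup K t j i := by
  have hU : IsUnit (Matrix.diagonal θ) := by
    rw [isUnit_diagonal, Pi.isUnit_iff]
    exact fun i => (hK.theta_pos i).ne'.isUnit
  have hD : Matrix.diagonal θ * K = Kᵀ * Matrix.diagonal θ := by
    ext a b
    rw [diagonal_mul, mul_diagonal, transpose_apply, hK.symm a b, mul_comm]
  have hdet : IsUnit (Matrix.diagonal θ).det := (isUnit_iff_isUnit_det _).1 hU
  have hconj : Matrix.diagonal θ * (t • K) * (Matrix.diagonal θ)⁻¹ = (t • K)ᵀ := by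
    rw [mul_smul_comm, hD, smul_mul_assoc, mul_assoc, mul_nonsing_inv _ hdet, mul_one,
      transpose_smul]
  have h := Matrix.exp_conj (Matrix.diagonal θ) (t • K) hU
  rw [hconj, Matrix.exp_transpose] at h
  have h2 : (semigroup K t)ᵀ * Matrix.diagonal θ = Matrix.diagonal θ * semigroup K t := by
    unfold semigroup
    rw [h, mul_assoc, nonsing_inv_mul _ hdet, mul_one]
  have h3 := congr_fun (congr_fun h2 i) j
  rw [mul_diagonal, diagonal_mul, transpose_apply] at h3
  linarith

omit [DecidableEq ι] in
theorem sum_generator_symm (g h : ι → ℝ) :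
    ∑ i, θ i * (g i * (K *ᵥ h) i) = ∑ i, θ i * ((K *ᵥ g) i * h i) := by
  simp only [mulVec, dotProduct, Finset.mul_sum, Finset.sum_mul]
  rw [Finset.sum_comm]
  refine Finset.sum_congr rfl fun j _ => Finset.sum_congr rfl fun i _ => ?_
  linear_combination (g i * h j) * hK.symm i j

omit [DecidableEq ι] in
theorem sum_mul_generator_nonpos (g : ι → ℝ) : ∑ i, θ i * (g i * (K *ᵥ g) i) ≤ 0 := by
  have h1 : ∑ i, θ i * (g i * (K *ᵥ g) i) = ∑ i, ∑ j, θ i * K i j * (g i * g j) := by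
    simp only [mulVec, dotProduct, Finset.mul_sum]
    exact Finset.sum_congr rfl fun i _ => Finset.sum_congr rfl fun j _ => by ring
  have h2 : ∑ i, ∑ j, θ i * K i j * (g i * g j) ≤
      ∑ i, ∑ j, (θ i * K i j * (g i ^ 2 / 2) + θ i * K i j * (g j ^ 2 / 2)) := by
    refine Finset.sum_le_sum fun i _ => Finset.sum_le_sum fun j _ => ?_
    by_cases hij : i = j
    · subst hij; exact le_of_eq (by ring)
    · have := mul_nonneg (hK.theta_pos i).le (hK.off_diag i j hij)
      nlinarith [mul_nonneg this (sq_nonneg (g i - g j))]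
  have h3 : ∑ i, ∑ j, θ i * K i j * (g j ^ 2 / 2) = ∑ i, ∑ j, θ i * K i j * (g i ^ 2 / 2) := by
    rw [Finset.sum_comm]
    exact Finset.sum_congr rfl fun i _ => Finset.sum_congr rfl fun j _ => by rw [hK.symm]
  have h4 : ∑ i, ∑ j, θ i * K i j * (g i ^ 2 / 2) ≤ 0 := by
    refine Finset.sum_nonpos fun i _ => ?_
    rw [← Finset.sum_mul, ← Finset.mul_sum]
    have := mul_nonpos_of_nonneg_of_nonpos (hK.theta_pos i).le (hK.row_sum i)
    exact mul_nonpos_of_nonpos_of_nonneg this (by positivity)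
  simp only [Finset.sum_add_distrib] at h2
  linarith

omit hK in
theorem hasDerivAt_norm_sq (g : ι → ℝ) (t : ℝ) :
    HasDerivAt (fun s => ∑ i, θ i * (semigroup K s *ᵥ g) i ^ 2)
      (2 * ∑ i, θ i * ((semigroup K t *ᵥ g) i * (K *ᵥ (semigroup K t *ᵥ g)) i)) t := by
  have h := HasDerivAt.fun_sum (u := Finset.univ)
    (fun i _ => ((hasDerivAt_semigroup_mulVec K g t i).pow 2).const_mul (θ i))
  refine HasDerivAt.congr_deriv h ?_
  rw [Finset.mul_sum]
  refine Finset.sum_congr rfl fun i _ => ?_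
  rw [semigroup_mulVec_comm]
  push_cast
  ring

theorem hasDerivAt_dirichlet (g : ι → ℝ) (t : ℝ) :
    HasDerivAt (fun s => 2 * ∑ i, θ i * ((semigroup K s *ᵥ g) i * (K *ᵥ (semigroup K s *ᵥ g)) i))
      (4 * ∑ i, θ i * (K *ᵥ (semigroup K t *ᵥ g)) i ^ 2) t := by
  have h1 : ∀ i, HasDerivAt (fun s => (semigroup K s *ᵥ g) i * (semigroup K s *ᵥ (K *ᵥ g)) i) _ t :=
    fun i => (hasDerivAt_semigroup_mulVec K g t i).mul (hasDerivAt_semigroup_mulVec K (K *ᵥ g) t i)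
  have h := (HasDerivAt.fun_sum (u := Finset.univ)
    (fun i _ => (h1 i).const_mul (θ i))).const_mul 2
  simp only [semigroup_mulVec_comm] at h1
  simp only [semigroup_mulVec_comm] at h
  refine HasDerivAt.congr_deriv h ?_
  have hs := hK.sum_generator_symm (semigroup K t *ᵥ g) (K *ᵥ (semigroup K t *ᵥ g))
  simp only [mul_add, Finset.sum_add_distrib]
  rw [hs]
  simp only [sq]
  ring

/-- Decay of the time derivative of a reversible semigroup in `L²`. -/
theorem sum_generator_sq_le (g : ι → ℝ) {t : ℝ} (ht : 0 < t) :
    ∑ i, θ i * (K *ᵥ (semigroup K t *ᵥ g)) i ^ 2 ≤ (∑ i, θ i * g i ^ 2) / t ^ 2 := by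
  have hanti : ∀ h : ι → ℝ, Antitone (fun s => ∑ i, θ i * (semigroup K s *ᵥ h) i ^ 2) := fun h =>
    antitone_of_hasDerivAt_nonpos (fun s => hasDerivAt_norm_sq h s) fun s =>
      mul_nonpos_of_nonneg_of_nonpos zero_le_two (hK.sum_mul_generator_nonpos _)
  set φ := fun s => ∑ i, θ i * (semigroup K s *ᵥ g) i ^ 2 with hφ
  set e := fun s =>
    2 * ∑ i, θ i * ((semigroup K s *ᵥ g) i * (K *ᵥ (semigroup K s *ᵥ g)) i) with he
  set ψ := fun s => ∑ i, θ i * (K *ᵥ (semigroup K s *ᵥ g)) i ^ 2 with hψ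
  have hψanti : Antitone ψ := by
    have := hanti (K *ᵥ g)
    simpa only [semigroup_mulVec_comm] using this
  have hψ0 : ∀ s, 0 ≤ ψ s := fun s =>
    Finset.sum_nonneg fun i _ => mul_nonneg (hK.theta_pos i).le (sq_nonneg _)
  have hφ0 : ∀ s, 0 ≤ φ s := fun s =>
    Finset.sum_nonneg fun i _ => mul_nonneg (hK.theta_pos i).le (sq_nonneg _)
  have hde : ∀ s, HasDerivAt e (4 * ψ s) s := hK.hasDerivAt_dirichlet g
  have hdφ : ∀ s, HasDerivAt φ (e s) s := hasDerivAt_norm_sq g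
  have he0 : ∀ s, e s ≤ 0 := fun s =>
    mul_nonpos_of_nonneg_of_nonpos zero_le_two (hK.sum_mul_generator_nonpos _)
  have hmono : Monotone e := monotone_of_hasDerivAt_nonneg hde fun s => by
    have := hψ0 s
    simp only [Pi.zero_apply]
    linarith
  obtain ⟨a, ⟨ha1, ha2⟩, ha⟩ := exists_hasDerivAt_eq_slope e (fun s => 4 * ψ s)
    (half_lt_self ht) (fun s _ => (hde s).continuousAt.continuousWithinAt) (fun s _ => hde s)
  obtain ⟨b, ⟨hb1, hb2⟩, hb⟩ := exists_hasDerivAt_eq_slope φ e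
    (half_pos ht) (fun s _ => (hdφ s).continuousAt.continuousWithinAt) (fun s _ => hdφ s)
  rw [eq_div_iff (by linarith)] at ha hb
  have h1 := hψanti ha2.le
  have h2 := hmono hb2.le
  have h3 := hφ0 (t / 2)
  have h4 := he0 t
  have h5 : φ 0 = ∑ i, θ i * g i ^ 2 := by simp [hφ, semigroup_zero]
  rw [← h5, le_div_iff₀ (by positivity)]
  have h6 : ψ t * 4 * (t / 2) ≤ - e (t / 2) := by nlinarith
  have h7 : - e (t / 2) * (t / 2) ≤ φ 0 := by nlinarith
  nlinarith

theorem sum_sq_semigroup (t : ℝ) (i : ι) :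
    ∑ k, θ k * (semigroup K t i k / θ k) ^ 2 = semigroup K (t + t) i i / θ i := by
  rw [semigroup_add, mul_apply, Finset.sum_div]
  refine Finset.sum_congr rfl fun k _ => ?_
  have h1 := (hK.theta_pos k).ne'
  have h2 := (hK.theta_pos i).ne'
  have h3 := hK.semigroup_symm t i k
  field_simp
  linear_combination (semigroup K t i k) * h3

/-- The time derivative of the heat kernel is controlled by its values on the diagonal. -/
theorem abs_deriv_kernel_le {t A : ℝ} (ht : 0 < t)
    (h1 : ∀ i, semigroup K t i i / θ i ≤ A) (h2 : ∀ i, semigroup K (t / 2) i i / θ i ≤ A)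
    (i j : ι) : |(K *ᵥ (fun k => semigroup K t k j / θ j)) i| ≤ 4 * A / t := by
  set q : ι → ℝ := fun k => semigroup K (t / 4) k j / θ j with hq
  have hq' : ∀ k, q k = semigroup K (t / 4) j k / θ k := fun k => by
    have := hK.semigroup_symm (t / 4) k j
    have h1 := (hK.theta_pos k).ne'
    have h2 := (hK.theta_pos j).ne'
    simp only [hq]
    field_simp
    linear_combination this
  have hdec : K *ᵥ (fun k => semigroup K t k j / θ j) =
      semigroup K (t / 2) *ᵥ (K *ᵥ (semigroup K (t / 4) *ᵥ q)) := by
    rw [semigroup_mulVec_comm, mulVec_mulVec (M := semigroup K (t / 2)), ← semigroup_add]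
    congr 1
    have ht' : t = (t / 2 + t / 4) + t / 4 := by ring
    ext k
    conv_lhs => rw [ht', semigroup_add, mul_apply, Finset.sum_div]
    simp only [mulVec, dotProduct, hq, mul_div_assoc]
  have hA : 0 ≤ A := by
    refine le_trans ?_ (h1 i)
    exact div_nonneg (hK.semigroup_nonneg ht.le i i) (hK.theta_pos i).le
  set v := K *ᵥ (semigroup K (t / 4) *ᵥ q) with hv
  have hvn : ∑ k, θ k * v k ^ 2 ≤ A / (t / 4) ^ 2 := by
    refine (hK.sum_generator_sq_le q (by positivity)).trans ?_
    gcongr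
    simp only [hq']
    rw [hK.sum_sq_semigroup]
    rw [show t / 4 + t / 4 = t / 2 by ring]
    exact h2 j
  have hpn : ∑ k, θ k * (semigroup K (t / 2) i k / θ k) ^ 2 ≤ A := by
    rw [hK.sum_sq_semigroup]
    rw [add_halves]
    exact h1 i
  have hcs := Finset.sum_mul_sq_le_sq_mul_sq Finset.univ
    (fun k => √(θ k) * (semigroup K (t / 2) i k / θ k)) (fun k => √(θ k) * v k)
  have e1 : ∀ k, √(θ k) * (semigroup K (t / 2) i k / θ k) * (√(θ k) * v k) =
      semigroup K (t / 2) i k * v k := fun k => by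
    have h := Real.mul_self_sqrt (hK.theta_pos k).le
    have h' := (hK.theta_pos k).ne'
    calc _ = (√(θ k) * √(θ k)) * (semigroup K (t / 2) i k / θ k) * v k := by ring
      _ = _ := by rw [h]; field_simp
  simp only [e1, mul_pow, Real.sq_sqrt (hK.theta_pos _).le] at hcs
  rw [hdec]
  change |∑ k, semigroup K (t / 2) i k * v k| ≤ _
  refine abs_le_of_sq_le_sq ?_ (by positivity)
  refine hcs.trans ((mul_le_mul hpn hvn ?_ hA).trans (le_of_eq ?_))
  · exact Finset.sum_nonneg fun k _ => mul_nonneg (hK.theta_pos k).le (sq_nonneg _)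
  · field_simp

/-- On-diagonal lower bound of the heat kernel by the survival probability. -/
theorem sq_survival_le {t : ℝ} (i : ι) :
    (semigroup K t *ᵥ 1) i ^ 2 ≤ (∑ k, θ k) * (semigroup K (t + t) i i / θ i) := by
  have hcs := Finset.sum_mul_sq_le_sq_mul_sq Finset.univ
    (fun k => √(θ k)) (fun k => √(θ k) * (semigroup K t i k / θ k))
  have e1 : ∀ k, √(θ k) * (√(θ k) * (semigroup K t i k / θ k)) =
      semigroup K t i k := fun k => by
    have h := Real.mul_self_sqrt (hK.theta_pos k).le
    have h' := (hK.theta_pos k).ne'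
    rw [← mul_assoc, h]; field_simp
  simp only [e1, mul_pow, Real.sq_sqrt (hK.theta_pos _).le] at hcs
  rw [hK.sum_sq_semigroup] at hcs
  simpa [mulVec, dotProduct] using hcs

theorem abs_mulVec_sub_le {t : ℝ} (ht : 0 ≤ t) {g : ι → ℝ} {F : ℝ}
    (hg : ∀ i, |(K *ᵥ g) i| ≤ F) (i : ι) : |(semigroup K t *ᵥ g) i - g i| ≤ F * t := by
  have h := Convex.norm_image_sub_le_of_norm_hasDerivWithin_le (f := fun s => (semigroup K s *ᵥ g) i)
    (f' := fun s => (semigroup K s *ᵥ (K *ᵥ g)) i) (C := F) (s := Ici 0) (x := 0) (y := t)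
    (fun s _ => (hasDerivAt_semigroup_mulVec K g s i).hasDerivWithinAt)
    (fun s hs => by
      have hF : 0 ≤ F := (abs_nonneg _).trans (hg i)
      rw [Real.norm_eq_abs]
      refine (hK.abs_mulVec_le hs hg i).trans ?_
      exact mul_le_of_le_one_right hF (hK.row_sum_le_one hs i))
    (convex_Ici 0) (mem_Ici.2 le_rfl) (mem_Ici.2 ht)
  simpa [semigroup_zero, abs_of_nonneg ht] using h

/-- If half of the mass is killed by time `t`, the Green operator has norm at most `2 t`. -/
theorem abs_le_of_generator_le {t : ℝ} (ht : 0 ≤ t) (hhalf : ∀ i, (semigroup K t *ᵥ 1) i ≤ 1 / 2)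
    {g : ι → ℝ} {F : ℝ} (hg : ∀ i, |(K *ᵥ g) i| ≤ F) (i : ι) : |g i| ≤ 2 * t * F := by
  obtain ⟨m, -, hm⟩ := Finset.exists_max_image Finset.univ (fun i => |g i|) ⟨i, Finset.mem_univ i⟩
  have h1 := hK.abs_mulVec_le ht (fun k => hm k (Finset.mem_univ k)) m
  have h2 := hK.abs_mulVec_sub_le ht hg m
  have h3 : |g m| * (semigroup K t *ᵥ 1) m ≤ |g m| * (1 / 2) :=
    mul_le_mul_of_nonneg_left (hhalf m) (abs_nonneg _)
  have h4 : |g m| ≤ |(semigroup K t *ᵥ g) m| + |(semigroup K t *ᵥ g) m - g m| := by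
    have := abs_sub_abs_le_abs_sub (g m) ((semigroup K t *ᵥ g) m)
    rw [abs_sub_comm] at this
    linarith
  have h5 := hm i (Finset.mem_univ i)
  linarith

theorem exists_generator_eq {t : ℝ} (ht : 0 ≤ t)
    (hhalf : ∀ i, (semigroup K t *ᵥ 1) i ≤ 1 / 2) (f : ι → ℝ) : ∃ g, K *ᵥ g = f := by
  have hinj : Function.Injective K.mulVecLin := by
    rw [← LinearMap.ker_eq_bot, LinearMap.ker_eq_bot']
    intro g hg
    ext i
    have hg' : K *ᵥ g = 0 := hg
    have := hK.abs_le_of_generator_le ht hhalf (g := g) (F := 0) (fun i => by simp [hg']) i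
    simpa using this
  obtain ⟨g, hg⟩ := (LinearMap.injective_iff_surjective.1 hinj) f
  exact ⟨g, hg⟩

theorem nonneg_of_generator_nonpos {t : ℝ} (ht : 0 ≤ t)
    (hhalf : ∀ i, (semigroup K t *ᵥ 1) i ≤ 1 / 2) {g : ι → ℝ} (hg : ∀ i, (K *ᵥ g) i ≤ 0) (i : ι) :
    0 ≤ g i := by
  obtain ⟨m, -, hm⟩ := Finset.exists_min_image Finset.univ g ⟨i, Finset.mem_univ i⟩
  refine le_trans ?_ (hm i (Finset.mem_univ i))
  by_contra! hneg
  have hanti : AntitoneOn (fun s => (semigroup K s *ᵥ g) m) (Ici 0) := by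
    refine antitoneOn_of_deriv_nonpos (convex_Ici 0)
      (fun s _ => (hasDerivAt_semigroup_mulVec K g s m).continuousAt.continuousWithinAt)
      (fun s _ => (hasDerivAt_semigroup_mulVec K g s m).differentiableAt.differentiableWithinAt)
      fun s hs => ?_
    rw [(hasDerivAt_semigroup_mulVec K g s m).deriv]
    rw [interior_Ici] at hs
    simpa using hK.mulVec_mono (le_of_lt hs) (h := 0) hg m
  have h1 := hanti (mem_Ici.2 le_rfl) (mem_Ici.2 ht) ht
  simp only [semigroup_zero, one_mulVec] at h1
  have h2 := hK.mulVec_mono ht (g := fun _ => g m) (h := g) (fun k => hm k (Finset.mem_univ k)) m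
  have h3 : (semigroup K t *ᵥ fun _ => g m) m = g m * (semigroup K t *ᵥ 1) m := by
    simp [mulVec, dotProduct, Finset.mul_sum, mul_comm]
  rw [h3] at h2
  nlinarith [hhalf m]

/-- A mean exit time is at most `s` plus the survival probability times the largest mean. -/
theorem le_add_survival {t s : ℝ} (ht : 0 ≤ t) (hs : 0 ≤ s)
    (hhalf : ∀ i, (semigroup K t *ᵥ 1) i ≤ 1 / 2) {g : ι → ℝ} (hg : ∀ i, (K *ᵥ g) i = -1) (i : ι) :
    g i ≤ s + 2 * t * (semigroup K s *ᵥ 1) i := by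
  have hF : ∀ i, |(K *ᵥ g) i| ≤ 1 := fun i => by simp [hg]
  have h1 := hK.abs_mulVec_le hs (fun k => hK.abs_le_of_generator_le ht hhalf hF k) i
  have h2 := hK.abs_mulVec_sub_le hs hF i
  have h3 := neg_abs_le ((semigroup K s *ᵥ g) i - g i)
  have h4 := le_abs_self ((semigroup K s *ᵥ g) i)
  linarith

/-- Comparison of a supersolution with the semigroup. -/
theorem semigroup_le_supersolution {v v' : ℝ → ι → ℝ} {a b : ℝ} (hab : a ≤ b)
    (hc : ∀ i, ContinuousOn (fun s => v s i) (Icc a b))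
    (hd : ∀ s ∈ Ioo a b, ∀ i, HasDerivAt (fun s => v s i) (v' s i) s)
    (hsup : ∀ s ∈ Ioo a b, ∀ i, (K *ᵥ v s) i ≤ v' s i) (i : ι) :
    (semigroup K (b - a) *ᵥ v a) i ≤ v b i := by
  set F : ℝ → ℝ := fun s => ∑ j, semigroup K (b - s) i j * v s j with hF
  have hder : ∀ s ∈ Ioo a b, HasDerivAt F
      ((semigroup K (b - s) *ᵥ (fun j => v' s j - (K *ᵥ v s) j)) i) s := by
    intro s hs
    have h1 : ∀ j, HasDerivAt (fun s => semigroup K (b - s) i j)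
        (-(semigroup K (b - s) * K) i j) s := fun j => by
      have := (hasDerivAt_semigroup_apply K (b - s) i j).comp s ((hasDerivAt_id s).const_sub b)
      simpa [Function.comp_def] using this
    have h := HasDerivAt.fun_sum (u := Finset.univ) (fun j _ => (h1 j).mul (hd s hs j))
    refine HasDerivAt.congr_deriv h ?_
    have h2 : ∑ j, -(semigroup K (b - s) * K) i j * v s j =
        -(semigroup K (b - s) *ᵥ (K *ᵥ v s)) i := by
      rw [mulVec_mulVec]
      simp [mulVec, dotProduct]
    rw [Finset.sum_add_distrib, h2]
    simp only [mulVec, dotProduct, mul_sub, Finset.sum_sub_distrib]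
    ring
  have hcont : ContinuousOn F (Icc a b) := by
    refine continuousOn_finsetSum _ fun j _ => ContinuousOn.mul ?_ (hc j)
    have : Continuous (fun s => semigroup K s i j) :=
      continuous_iff_continuousAt.2 fun s => (hasDerivAt_semigroup_apply K s i j).continuousAt
    exact (this.comp (continuous_const.sub continuous_id)).continuousOn
  have hmono : MonotoneOn F (Icc a b) := by
    refine monotoneOn_of_deriv_nonneg (convex_Icc a b) hcont
      (fun s hs => ?_) (fun s hs => ?_)
    · rw [interior_Icc] at hs
      exact (hder s hs).differentiableAt.differentiableWithinAt
    · rw [interior_Icc] at hs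
      rw [(hder s hs).deriv]
      exact hK.mulVec_nonneg (sub_nonneg.2 hs.2.le) (fun j => sub_nonneg.2 (hsup s hs j)) i
  have h := hmono (left_mem_Icc.2 hab) (right_mem_Icc.2 hab) hab
  have h2 : F b = v b i := by
    simp [hF, semigroup_zero, one_apply]
  rw [h2] at h
  exact h

end IsSubMarkov

end Semigroup
end

noncomputable section

/-! ### The walk killed outside a finite set of vertices -/

namespace WeightedGraph

open Matrix

variable {V : Type*} {Γ : WeightedGraph V}

theorem DegreeLE.finite_neighbors {M : ℕ} (h : Γ.DegreeLE M) (x : V) :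
    {y | 0 < Γ.weight x y}.Finite := by
  refine Set.encard_lt_top_iff.1 ((h x).trans_lt ?_)
  exact WithTop.coe_lt_top M

theorem finite_walk_length (hfin : ∀ x, {y | 0 < Γ.weight x y}.Finite) (n : ℕ) (x : V) :
    {y | ∃ p : Γ.toGraph.Walk x y, p.length = n}.Finite := by
  induction n generalizing x with
  | zero =>
    refine (Set.finite_singleton x).subset ?_
    rintro y ⟨p, hp⟩
    exact (SimpleGraph.Walk.eq_of_length_eq_zero hp).symm
  | succ n ih =>
    refine ((hfin x).biUnion fun z _ => ih z).subset ?_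
    rintro y ⟨p, hp⟩
    cases p with
    | nil => simp at hp
    | cons hadj q =>
      refine mem_biUnion (show _ ∈ {y | 0 < Γ.weight x y} from hadj.2) ⟨q, ?_⟩
      simpa using hp

theorem finite_ball (hconn : Γ.IsConnected) (hfin : ∀ x, {y | 0 < Γ.weight x y}.Finite)
    (x : V) (R : ℝ) : (Γ.ball x R).Finite := by
  refine ((Set.finite_Iio ⌈R⌉₊).biUnion fun n _ => finite_walk_length hfin n x).subset ?_
  intro y hy
  obtain ⟨p, hp⟩ := SimpleGraph.Connected.exists_walk_length_eq_dist hconn x y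
  refine mem_biUnion (x := p.length) ?_ ⟨p, rfl⟩
  rw [hp]
  exact Nat.lt_ceil.2 hy

theorem cond_eq_sum (hfin : ∀ x, {y | 0 < Γ.weight x y}.Finite) (x : V) :
    Γ.cond x = ∑ y ∈ (hfin x).toFinset, Γ.weight x y := by
  refine finsum_eq_sum_of_support_subset _ fun y hy => ?_
  simp only [Finite.coe_toFinset, mem_ofPred_eq]
  exact lt_of_le_of_ne (Γ.weight_nonneg x y) (Ne.symm hy)

theorem cond_nonneg (x : V) : 0 ≤ Γ.cond x := finsum_nonneg fun y => Γ.weight_nonneg x y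

theorem theta_nonneg (w : WalkType) (x : V) : 0 ≤ Γ.theta w x := by
  cases w
  · exact cond_nonneg x
  · exact zero_le_one

theorem cond_pos [Nontrivial V] (hconn : Γ.IsConnected)
    (hfin : ∀ x, {y | 0 < Γ.weight x y}.Finite) (x : V) : 0 < Γ.cond x := by
  obtain ⟨y, hy⟩ := exists_ne x
  obtain ⟨p⟩ := SimpleGraph.Connected.preconnected hconn x y
  cases p with
  | nil => exact absurd rfl hy
  | @cons _ z _ hadj q =>
    rw [cond_eq_sum hfin]
    exact Finset.sum_pos' (fun y _ => Γ.weight_nonneg x y) ⟨z, by simpa using hadj.2, hadj.2⟩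

theorem theta_pos (hπ : ∀ x, 0 < Γ.cond x) (w : WalkType) (x : V) : 0 < Γ.theta w x := by
  cases w
  · exact hπ x
  · exact zero_lt_one

theorem mem_ball_self (x : V) {R : ℝ} (hR : 0 < R) : x ∈ Γ.ball x R := by
  simpa [ball] using hR

theorem ball_mono (x : V) {r R : ℝ} (h : r ≤ R) : Γ.ball x r ⊆ Γ.ball x R :=
  fun _ hy => lt_of_lt_of_le hy h

theorem mem_ball_of_weight_pos (hconn : Γ.IsConnected) {x₀ x y : V} {R : ℝ}
    (hx : x ∈ Γ.ball x₀ R) (hxy : 0 < Γ.weight x y) : y ∈ Γ.ball x₀ (R + 1) := by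
  have h1 : Γ.toGraph.dist x₀ y ≤ Γ.toGraph.dist x₀ x + Γ.toGraph.dist x y :=
    SimpleGraph.Connected.dist_triangle hconn
  have h2 : Γ.toGraph.dist x y ≤ 1 := by
    by_cases h : x = y
    · subst h; simp
    · exact (SimpleGraph.dist_eq_one_iff_adj.2 (⟨h, hxy⟩ : Γ.toGraph.Adj x y)).le
  have h3 : (Γ.toGraph.dist x₀ y : ℝ) ≤ Γ.toGraph.dist x₀ x + 1 := by
    exact_mod_cast h1.trans (by omega)
  have h4 : (Γ.toGraph.dist x₀ x : ℝ) < R := hx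
  exact h3.trans_lt (by linarith)

theorem closure_ball_subset (hconn : Γ.IsConnected) (x₀ : V) (R : ℝ) :
    Γ.closure (Γ.ball x₀ R) ⊆ Γ.ball x₀ (R + 1) := by
  rintro y (hy | ⟨x, hx, hxy⟩)
  · exact ball_mono x₀ (by linarith) hy
  · exact mem_ball_of_weight_pos hconn hx hxy

theorem mass_eq_sum (w : WalkType) (B : Finset V) : Γ.mass w B = ∑ x ∈ B, Γ.theta w x := by
  unfold mass
  exact finsum_mem_coe_finset _ _

theorem laplacian_eq (hfin : ∀ x, {y | 0 < Γ.weight x y}.Finite) (w : WalkType) (f : V → ℝ)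
    (x : V) (S : Finset V) (hS : (hfin x).toFinset ⊆ S) :
    Γ.laplacian w f x = (∑ y ∈ S, Γ.weight x y * f y - Γ.cond x * f x) / Γ.theta w x := by
  have hzero : ∀ y ∉ S, Γ.weight x y = 0 := fun y hy => by
    by_contra hne
    exact hy (hS (by simpa using lt_of_le_of_ne (Γ.weight_nonneg x y) (Ne.symm hne)))
  have h1 : ∑ᶠ y, (f y - f x) * Γ.weight x y = ∑ y ∈ S, (f y - f x) * Γ.weight x y := by
    refine finsum_eq_sum_of_support_subset _ fun y hy => ?_
    by_contra hyS
    exact hy (by simp [hzero y hyS])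
  have h2 : Γ.cond x = ∑ y ∈ S, Γ.weight x y := by
    refine finsum_eq_sum_of_support_subset _ fun y hy => ?_
    by_contra hyS
    exact hy (hzero y hyS)
  rw [laplacian, h1, h2, Finset.sum_mul, ← Finset.sum_sub_distrib, one_div, inv_mul_eq_div]
  congr 1
  exact Finset.sum_congr rfl fun y _ => by ring

theorem laplacian_sub_const (w : WalkType) (f : V → ℝ) (m : ℝ) (x : V) :
    Γ.laplacian w (fun y => f y - m) x = Γ.laplacian w f x := by
  simp [laplacian]

theorem laplacian_const_sub (w : WalkType) (f : V → ℝ) (m : ℝ) (x : V) :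
    Γ.laplacian w (fun y => m - f y) x = -Γ.laplacian w f x := by
  unfold laplacian
  rw [← mul_neg, ← finsum_neg_distrib]
  congr 1
  exact finsum_congr fun y => by ring

open Classical in
/-- The generator of the walk killed when it leaves `B`. -/
def killedGenerator (Γ : WeightedGraph V) (w : WalkType) (B : Finset V) : Matrix B B ℝ :=
  fun x y => (Γ.weight x y - if x = y then Γ.cond x else 0) / Γ.theta w x

theorem killedGenerator_mulVec (w : WalkType) (B : Finset V) (g : B → ℝ) (x : B) :
    (Γ.killedGenerator w B *ᵥ g) x =
      (∑ y : B, Γ.weight x y * g y - Γ.cond x * g x) / Γ.theta w x := by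
  classical
  simp only [mulVec, dotProduct, killedGenerator, div_mul_eq_mul_div, ← Finset.sum_div, sub_mul,
    Finset.sum_sub_distrib, ite_mul, zero_mul, Finset.sum_ite_eq, Finset.mem_univ, if_true]

theorem isSubMarkov_killedGenerator (hfin : ∀ x, {y | 0 < Γ.weight x y}.Finite)
    (hπ : ∀ x, 0 < Γ.cond x) (w : WalkType) (B : Finset V) :
    IsSubMarkov (Γ.killedGenerator w B) (fun x => Γ.theta w x) where
  theta_pos x := theta_pos hπ w x
  off_diag x y hxy := by
    simp only [killedGenerator, if_neg hxy, sub_zero]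
    exact div_nonneg (Γ.weight_nonneg _ _) (theta_nonneg w _)
  row_sum x := by
    have h := killedGenerator_mulVec (Γ := Γ) w B (fun _ => 1) x
    have h' : ∑ y, Γ.killedGenerator w B x y =
        (∑ y : B, Γ.weight x y - Γ.cond x) / Γ.theta w x := by
      simpa only [mulVec, dotProduct, mul_one] using h
    rw [h']
    refine div_nonpos_of_nonpos_of_nonneg (sub_nonpos.2 ?_) (theta_nonneg w _)
    classical
    rw [Finset.sum_coe_sort B (fun y => Γ.weight x y), cond_eq_sum hfin]
    rw [← Finset.sum_filter_add_sum_filter_not B (fun y => 0 < Γ.weight x y)]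
    rw [Finset.sum_eq_zero (s := B.filter fun y => ¬ 0 < Γ.weight x y) (fun y hy =>
      le_antisymm (not_lt.1 (Finset.mem_filter.1 hy).2) (Γ.weight_nonneg _ _)), add_zero]
    refine Finset.sum_le_sum_of_subset_of_nonneg (fun y hy => ?_) fun y _ _ => Γ.weight_nonneg _ _
    simpa using (Finset.mem_filter.1 hy).2
  symm x y := by
    have h1 := (theta_pos hπ w x).ne'
    have h2 := (theta_pos hπ w y).ne'
    simp only [killedGenerator]
    rw [mul_div_cancel₀ _ h1, mul_div_cancel₀ _ h2, Γ.weight_symm]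
    by_cases h : x = y
    · subst h; rfl
    · simp [h, Ne.symm h]

theorem laplacian_eq_killed (hfin : ∀ x, {y | 0 < Γ.weight x y}.Finite) (w : WalkType)
    {B : Finset V} {f : V → ℝ} (hf : ∀ y ∉ B, f y = 0) (x : B) :
    Γ.laplacian w f x = (Γ.killedGenerator w B *ᵥ fun y => f y) x := by
  classical
  rw [laplacian_eq hfin w f x ((hfin x).toFinset ∪ B) Finset.subset_union_left,
    killedGenerator_mulVec, Finset.sum_coe_sort B (fun y => Γ.weight x y * f y)]
  congr 2
  refine (Finset.sum_subset Finset.subset_union_right fun y _ hy => ?_).symm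
  rw [hf y hy, mul_zero]

theorem killed_le_laplacian (hfin : ∀ x, {y | 0 < Γ.weight x y}.Finite) (w : WalkType)
    {B : Finset V} {f : V → ℝ} (hf : ∀ y ∈ Γ.closure B, 0 ≤ f y) (x : B) :
    (Γ.killedGenerator w B *ᵥ fun y => f y) x ≤ Γ.laplacian w f x := by
  classical
  rw [laplacian_eq hfin w f x ((hfin x).toFinset ∪ B) Finset.subset_union_left,
    killedGenerator_mulVec, Finset.sum_coe_sort B (fun y => Γ.weight x y * f y)]
  refine div_le_div_of_nonneg_right (sub_le_sub_right ?_ _) (theta_nonneg w _)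
  refine Finset.sum_le_sum_of_subset_of_nonneg Finset.subset_union_right fun y hy _ => ?_
  refine mul_nonneg (Γ.weight_nonneg _ _) (hf y ?_)
  rcases Finset.mem_union.1 hy with h | h
  · exact Or.inr ⟨x, x.2, by simpa using h⟩
  · exact Or.inl h

open Classical in
/-- The heat kernel of the walk killed outside `B`, extended by zero. -/
def killedKernel (Γ : WeightedGraph V) (w : WalkType) (B : Finset V) (t : ℝ) (x y : V) : ℝ :=
  if h : x ∈ B ∧ y ∈ B then
    semigroup (Γ.killedGenerator w B) t ⟨x, h.1⟩ ⟨y, h.2⟩ / Γ.theta w y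
  else 0

open Classical in
/-- The probability that the walk started at `x` has not left `B` by time `t`. -/
def survival (Γ : WeightedGraph V) (w : WalkType) (B : Finset V) (t : ℝ) (x : B) : ℝ :=
  (semigroup (Γ.killedGenerator w B) t *ᵥ 1) x

open Classical in
theorem killedKernel_coe (w : WalkType) (B : Finset V) (t : ℝ) (x y : B) :
    Γ.killedKernel w B t x y =
      semigroup (Γ.killedGenerator w B) t x y / Γ.theta w y := by
  simp [killedKernel]

theorem killedKernel_nonneg (hfin : ∀ x, {y | 0 < Γ.weight x y}.Finite)
    (hπ : ∀ x, 0 < Γ.cond x) (w : WalkType) (B : Finset V) {t : ℝ} (ht : 0 ≤ t) (x y : V) :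
    0 ≤ Γ.killedKernel w B t x y := by
  classical
  unfold killedKernel
  split_ifs
  · exact div_nonneg ((isSubMarkov_killedGenerator hfin hπ w B).semigroup_nonneg ht _ _)
      (theta_nonneg w y)
  · exact le_rfl

theorem killedKernel_symm (hfin : ∀ x, {y | 0 < Γ.weight x y}.Finite)
    (hπ : ∀ x, 0 < Γ.cond x) (w : WalkType) (B : Finset V) (t : ℝ) (x y : V) :
    Γ.killedKernel w B t x y = Γ.killedKernel w B t y x := by
  classical
  unfold killedKernel
  by_cases h : x ∈ B ∧ y ∈ B
  · rw [dif_pos h, dif_pos h.symm]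
    have h1 := (theta_pos hπ w x).ne'
    have h2 := (theta_pos hπ w y).ne'
    have := (isSubMarkov_killedGenerator hfin hπ w B).semigroup_symm t ⟨x, h.1⟩ ⟨y, h.2⟩
    rw [div_eq_div_iff h2 h1]
    linarith
  · rw [dif_neg h, dif_neg (fun h' => h h'.symm)]

/-- Oscillation decay for functions with bounded Laplacian, from the elliptic Harnack inequality. -/
theorem elliptic_oscillation (hconn : Γ.IsConnected)
    (hfin : ∀ x, {y | 0 < Γ.weight x y}.Finite) (hπ : ∀ x, 0 < Γ.cond x) (w : WalkType)
    {x₀ : V} {R C t : ℝ} (hC : 0 < C) (B : Finset V) (hB : (B : Set V) = Γ.ball x₀ R)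
    (hEHI : ∀ h : V → ℝ, (∀ x ∈ Γ.closure (Γ.ball x₀ R), 0 ≤ h x) →
      (∀ x ∈ Γ.ball x₀ R, Γ.laplacian w h x = 0) →
      ∀ x ∈ Γ.ball x₀ (R / 2), ∀ y ∈ Γ.ball x₀ (R / 2), h x ≤ C * h y)
    (hR : 0 ≤ R) (ht : 0 ≤ t) (hhalf : ∀ x, Γ.survival w B t x ≤ 1 / 2)
    {u : V → ℝ} {F m D : ℝ} (hF : ∀ x ∈ Γ.ball x₀ R, |Γ.laplacian w u x| ≤ F)
    (hu : ∀ x ∈ Γ.ball x₀ (R + 1), m ≤ u x ∧ u x ≤ m + D) (x y : V)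
    (hx : x ∈ Γ.ball x₀ (R / 2)) (hy : y ∈ Γ.ball x₀ (R / 2)) :
    u x - u y ≤ C / (C + 1) * D + 8 * t * F := by
  classical
  have hK := isSubMarkov_killedGenerator hfin hπ w B
  have hmem : ∀ z, z ∈ B ↔ z ∈ Γ.ball x₀ R := fun z => by rw [← hB]; rfl
  obtain ⟨g, hg⟩ := hK.exists_generator_eq ht hhalf (fun z => -Γ.laplacian w u z)
  set e := 2 * t * F with he
  have hge : ∀ z, |g z| ≤ e := hK.abs_le_of_generator_le ht hhalf fun z => by
    rw [hg, abs_neg]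
    exact hF z ((hmem z).1 z.2)
  set G : V → ℝ := fun z => if h : z ∈ B then g ⟨z, h⟩ else 0 with hG
  have hx' : x ∈ Γ.ball x₀ R := ball_mono x₀ (by linarith) hx
  have hy' : y ∈ Γ.ball x₀ R := ball_mono x₀ (by linarith) hy
  have he0 : 0 ≤ e := (abs_nonneg _).trans (hge ⟨x, (hmem x).2 hx'⟩)
  have hGe : ∀ z, |G z| ≤ e := fun z => by
    simp only [hG]
    split_ifs
    · exact hge _
    · simpa using he0
  have hharm : ∀ z ∈ Γ.ball x₀ R, Γ.laplacian w (fun z => u z + G z) z = 0 := by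
    intro z hz
    have h1 := laplacian_eq_killed hfin w (f := G) (fun y hy => by simp [hG, hy])
      ⟨z, (hmem z).2 hz⟩
    have h2 : (fun y : B => G y) = g := by ext y; simp [hG]
    rw [h2, hg] at h1
    have h3 : Γ.laplacian w (fun z => u z + G z) z = Γ.laplacian w u z + Γ.laplacian w G z := by
      simp only [laplacian_eq hfin w _ z (hfin z).toFinset subset_rfl]
      rw [← add_div]
      simp only [mul_add, Finset.sum_add_distrib]
      ring
    rw [h3, h1]
    simp
  have hbd : ∀ z ∈ Γ.closure (Γ.ball x₀ R), m - e ≤ u z + G z ∧ u z + G z ≤ m + D + e := by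
    intro z hz
    have h1 := hu z (closure_ball_subset hconn x₀ R hz)
    have h2 := abs_le.1 (hGe z)
    constructor <;> linarith
  have key1 := hEHI (fun z => (u z + G z) - (m - e)) (fun z hz => sub_nonneg.2 (hbd z hz).1)
    (fun z hz => by rw [laplacian_sub_const w (fun z => u z + G z), hharm z hz]) x hx y hy
  have key2 := hEHI (fun z => (m + D + e) - (u z + G z)) (fun z hz => sub_nonneg.2 (hbd z hz).2)
    (fun z hz => by rw [laplacian_const_sub w (fun z => u z + G z), hharm z hz, neg_zero]) y hy x hx
  have h1 := abs_le.1 (hGe x)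
  have h2 := abs_le.1 (hGe y)
  have hD : 0 ≤ D := by
    have := hu x (ball_mono x₀ (by linarith) hx')
    linarith
  set Δ := (u x + G x) - (u y + G y) with hΔ
  have h3 : Δ * (C + 1) ≤ C * (D + 2 * e) := by nlinarith
  have h4 : Δ ≤ C / (C + 1) * (D + 2 * e) := by
    rw [div_mul_eq_mul_div, le_div_iff₀ (by linarith)]
    exact h3
  have h5 : C / (C + 1) ≤ 1 := by
    rw [div_le_one (by linarith)]; linarith
  have h6 : C / (C + 1) * (2 * e) ≤ 2 * e := by nlinarith
  have h7 : u x - u y = Δ - G x + G y := by rw [hΔ]; ring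
  rw [h7]
  nlinarith

/-- A nonnegative solution of the heat equation dominates the killed semigroup. -/
theorem sum_killedKernel_le (hfin : ∀ x, {y | 0 < Γ.weight x y}.Finite)
    (hπ : ∀ x, 0 < Γ.cond x) (w : WalkType) (B : Finset V) {v : ℝ → V → ℝ} {a b : ℝ} (hab : a ≤ b)
    (hc : ∀ x ∈ B, ContinuousOn (fun s => v s x) (Icc a b))
    (hd : ∀ s ∈ Ioo a b, ∀ x ∈ B, HasDerivAt (fun s => v s x) (Γ.laplacian w (v s) x) s)
    (h0 : ∀ s ∈ Ioo a b, ∀ x ∈ Γ.closure B, 0 ≤ v s x) {x : V} (hx : x ∈ B) :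
    ∑ y ∈ B, Γ.killedKernel w B (b - a) x y * Γ.theta w y * v a y ≤ v b x := by
  classical
  have hK := isSubMarkov_killedGenerator hfin hπ w B
  have h := hK.semigroup_le_supersolution (v := fun s (y : B) => v s y)
    (v' := fun s y => Γ.laplacian w (v s) y) hab (fun y => hc y y.2)
    (fun s hs y => hd s hs y y.2) (fun s hs y => killed_le_laplacian hfin w (h0 s hs) y) ⟨x, hx⟩
  refine le_trans (le_of_eq ?_) h
  rw [← Finset.sum_coe_sort B]
  refine Finset.sum_congr rfl fun y _ => ?_
  have := killedKernel_coe (Γ := Γ) w B (b - a) ⟨x, hx⟩ y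
  simp only at this
  rw [this, div_mul_cancel₀ _ (theta_pos hπ w y).ne']

end WeightedGraph

end

noncomputable section

/-! ### Sums of independent exponential holding times -/

section Exponential

instance isProbabilityMeasure_expMeasure_one : IsProbabilityMeasure (expMeasure 1) :=
  isProbabilityMeasure_expMeasure one_pos

/-- The law of a sequence of independent exponential variables of mean one. -/
def expSequence : Measure (ℕ → ℝ) := Measure.infinitePi fun _ : ℕ => expMeasure 1

instance : IsProbabilityMeasure expSequence := by unfold expSequence; infer_instance

/-- The `n`-th holding time, with rates `l`. -/
def holding (l : ℕ → ℝ) (n : ℕ) (e : ℕ → ℝ) : ℝ := max (e n) 0 / l n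

/-- The time of the `n`-th jump, with rates `l`. -/
def arrival (l : ℕ → ℝ) (n : ℕ) (e : ℕ → ℝ) : ℝ := ∑ i ∈ Finset.range n, holding l i e

/-- The probability that exactly `n` jumps have occurred by time `t`. -/
def residence (l : ℕ → ℝ) (n : ℕ) (t : ℝ) : ℝ≥0∞ :=
  expSequence {e | arrival l n e ≤ t ∧ t < arrival l (n + 1) e}

theorem measurable_holding (l : ℕ → ℝ) (n : ℕ) : Measurable (holding l n) := by
  unfold holding
  fun_prop

theorem measurable_arrival (l : ℕ → ℝ) (n : ℕ) : Measurable (arrival l n) := by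
  have := measurable_holding l
  unfold arrival
  fun_prop

theorem holding_nonneg {l : ℕ → ℝ} (hl : ∀ i, 0 < l i) (n : ℕ) (e : ℕ → ℝ) : 0 ≤ holding l n e :=
  div_nonneg (le_max_right _ _) (hl n).le

theorem arrival_nonneg {l : ℕ → ℝ} (hl : ∀ i, 0 < l i) (n : ℕ) (e : ℕ → ℝ) : 0 ≤ arrival l n e :=
  Finset.sum_nonneg fun i _ => holding_nonneg hl i e

theorem lintegral_expMeasure_one {f : ℝ → ℝ≥0∞} (hf : Measurable f) :
    ∫⁻ a, f a ∂expMeasure 1 = ∫⁻ a in Ioi 0, ENNReal.ofReal (Real.exp (-a)) * f a := by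
  have h1 : expMeasure 1 = volume.withDensity (exponentialPDF 1) := rfl
  have hm : Measurable (exponentialPDF 1) := by
    unfold exponentialPDF
    fun_prop
  rw [h1, lintegral_withDensity_eq_lintegral_mul _ hm hf, ← lintegral_indicator measurableSet_Ioi]
  refine lintegral_congr_ae ?_
  have h0 : ∀ᵐ a : ℝ, a ≠ 0 := by simp [ae_iff]
  filter_upwards [h0] with a ha
  rcases lt_or_gt_of_ne ha with h | h
  · simp [exponentialPDF_of_neg h, Set.indicator, not_lt.2 h.le]
  · simp [exponentialPDF_of_nonneg h.le, Set.indicator, h]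

theorem lintegral_ofReal_expMeasure_one : ∫⁻ a, ENNReal.ofReal a ∂expMeasure 1 = 1 := by
  rw [lintegral_expMeasure_one (by fun_prop)]
  have h1 : ∫⁻ a in Ioi (0 : ℝ), ENNReal.ofReal (Real.exp (-a)) * ENNReal.ofReal a =
      ∫⁻ a in Ioi (0 : ℝ), ENNReal.ofReal (Real.exp (-a) * a ^ ((2 : ℝ) - 1)) := by
    refine lintegral_congr fun a => ?_
    rw [← ENNReal.ofReal_mul (Real.exp_pos _).le]
    norm_num
  rw [h1, ← ofReal_integral_eq_lintegral_ofReal (Real.GammaIntegral_convergent two_pos),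
    ← Real.Gamma_eq_integral two_pos, Real.Gamma_two, ENNReal.ofReal_one]
  filter_upwards [ae_restrict_mem measurableSet_Ioi] with a ha
  exact mul_nonneg (Real.exp_pos _).le (Real.rpow_nonneg (le_of_lt ha) _)

theorem lintegral_holding {l : ℕ → ℝ} (hl : ∀ i, 0 < l i) (n : ℕ) {f : ℝ → ℝ≥0∞}
    (hf : Measurable f) : ∫⁻ e, f (holding l n e) ∂expSequence =
      ∫⁻ t in Ioi 0, ENNReal.ofReal (l n * Real.exp (-(l n * t))) * f t := by
  have h1 : ∫⁻ e, f (holding l n e) ∂expSequence = ∫⁻ a, f (max a 0 / l n) ∂expMeasure 1 :=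
    (measurePreserving_eval_infinitePi (fun _ : ℕ => expMeasure 1) n).lintegral_comp
      (f := fun a => f (max a 0 / l n)) (by fun_prop)
  have himg : (fun t => l n * t) '' Ioi 0 = Ioi (0 : ℝ) := by
    rw [Set.image_mul_left_Ioi (hl n), mul_zero]
  rw [h1, lintegral_expMeasure_one (by fun_prop), ← himg,
    lintegral_image_eq_lintegral_abs_deriv_mul measurableSet_Ioi
      (f' := fun _ => l n) (fun x _ => by
        simpa using ((hasDerivAt_id x).const_mul (l n)).hasDerivWithinAt)
      (fun a _ b _ hab => mul_left_cancel₀ (hl n).ne' hab), himg]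
  refine setLIntegral_congr_fun measurableSet_Ioi fun t ht => ?_
  have ht' : (0 : ℝ) < t := ht
  have h2 : max (l n * t) 0 / l n = t := by
    rw [max_eq_left (mul_pos (hl n) ht').le, mul_div_cancel_left₀ _ (hl n).ne']
  simp only [h2]
  rw [abs_of_pos (hl n), ← mul_assoc, ← ENNReal.ofReal_mul (hl n).le]

theorem lintegral_arrival_holding {l : ℕ → ℝ} (hl : ∀ i, 0 < l i) (n : ℕ) {f : ℝ × ℝ → ℝ≥0∞}
    (hf : Measurable f) : ∫⁻ e, f (arrival l n e, holding l n e) ∂expSequence =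
      ∫⁻ e, (∫⁻ t in Ioi 0, ENNReal.ofReal (l n * Real.exp (-(l n * t))) * f (arrival l n e, t))
        ∂expSequence := by
  have hind : iIndepFun (fun i e => holding l i e) expSequence :=
    iIndepFun_infinitePi (P := fun _ : ℕ => expMeasure 1) (X := fun i a => max a 0 / l i)
      (fun i => by fun_prop)
  have hind2 : IndepFun (arrival l n) (holding l n) expSequence := by
    have h := hind.indepFun_finsetSum_of_notMem (measurable_holding l) (s := Finset.range n) (i := n)
      (by simp)
    have h2 : ∑ j ∈ Finset.range n, holding l j = arrival l n := by
      ext e; simp [arrival]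
    rwa [h2] at h
  have hmap := hind2.map_prod_eq_prod_map_map (measurable_arrival l n).aemeasurable
    (measurable_holding l n).aemeasurable
  rw [← lintegral_map hf ((measurable_arrival l n).prodMk (measurable_holding l n)), hmap,
    lintegral_prod _ hf.aemeasurable, lintegral_map (hf.lintegral_prod_right')
      (measurable_arrival l n)]
  refine lintegral_congr fun e => ?_
  rw [lintegral_map (by fun_prop) (measurable_holding l n)]
  exact lintegral_holding hl n (f := fun t => f (arrival l n e, t)) (by fun_prop)

theorem lintegral_exp_tail {r c : ℝ} (hr : 0 < r) :
    ∫⁻ t in Ioi c, ENNReal.ofReal (r * Real.exp (-(r * t))) = ENNReal.ofReal (Real.exp (-(r * c))) := by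
  have hint : IntegrableOn (fun t => Real.exp (-r * t)) (Ioi c) := exp_neg_integrableOn_Ioi c hr
  have hint2 : IntegrableOn (fun t => r * Real.exp (-(r * t))) (Ioi c) := by
    have h := Integrable.const_mul hint r
    simp only [neg_mul] at h
    exact h
  rw [← ofReal_integral_eq_lintegral_ofReal hint2]
  · congr 1
    have h := integral_exp_mul_Ioi (a := -r) (by linarith) c
    rw [integral_const_mul]
    simp only [neg_mul] at h
    rw [h]
    field_simp
  · exact Filter.Eventually.of_forall fun t => mul_nonneg hr.le (Real.exp_pos _).le

theorem residence_eq_lintegral {l : ℕ → ℝ} (hl : ∀ i, 0 < l i) (n : ℕ) (t : ℝ) :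
    residence l n t = ∫⁻ e, (Iic t).indicator
      (fun s => ENNReal.ofReal (Real.exp (-(l n * (t - s))))) (arrival l n e) ∂expSequence := by
  have hset : MeasurableSet {p : ℝ × ℝ | p.1 ≤ t ∧ t < p.1 + p.2} := by measurability
  have h1 : residence l n t =
      ∫⁻ e, {p : ℝ × ℝ | p.1 ≤ t ∧ t < p.1 + p.2}.indicator 1 (arrival l n e, holding l n e)
        ∂expSequence := by
    have hm : MeasurableSet {e | arrival l n e ≤ t ∧ t < arrival l (n + 1) e} :=
      (measurableSet_le (measurable_arrival l n) measurable_const).inter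
        (measurableSet_lt measurable_const (measurable_arrival l (n + 1)))
    rw [residence, ← lintegral_indicator_one hm]
    refine lintegral_congr fun e => ?_
    simp only [Set.indicator, arrival, Finset.sum_range_succ, mem_ofPred_eq, Pi.one_apply]
    congr
  rw [h1, lintegral_arrival_holding hl n (measurable_one.indicator hset)]
  refine lintegral_congr fun e => ?_
  by_cases h : arrival l n e ≤ t
  · rw [Set.indicator_of_mem (show arrival l n e ∈ Iic t from h),
      ← lintegral_exp_tail (hl n), ← lintegral_indicator measurableSet_Ioi,
      ← lintegral_indicator measurableSet_Ioi]
    refine lintegral_congr fun s => ?_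
    by_cases hs : t - arrival l n e < s
    · have h2 : 0 < s := lt_of_le_of_lt (sub_nonneg.2 h) hs
      have h3 : t < arrival l n e + s := by linarith
      simp [Set.indicator, hs, h2, h3, h]
    · have h3 : ¬ t < arrival l n e + s := by linarith
      simp [Set.indicator, hs, h3]
  · rw [Set.indicator_of_notMem (show arrival l n e ∉ Iic t from h)]
    simp [Set.indicator, h]

theorem residence_zero {l : ℕ → ℝ} (hl : ∀ i, 0 < l i) {t : ℝ} (ht : 0 ≤ t) :
    residence l 0 t = ENNReal.ofReal (Real.exp (-(l 0 * t))) := by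
  rw [residence_eq_lintegral hl]
  simp [arrival, Set.indicator, ht]

theorem lintegral_arrival_succ {l : ℕ → ℝ} (hl : ∀ i, 0 < l i) (n : ℕ) {f : ℝ → ℝ≥0∞}
    (hf : Measurable f) : ∫⁻ e, f (arrival l (n + 1) e) ∂expSequence =
      ∫⁻ s, ENNReal.ofReal (l n) * residence l n s * f s := by
  have h1 : ∀ e, f (arrival l (n + 1) e) =
      (fun p : ℝ × ℝ => f (p.1 + p.2)) (arrival l n e, holding l n e) := fun e => by
    simp [arrival, Finset.sum_range_succ]
  simp only [h1]
  rw [lintegral_arrival_holding hl n (f := fun p : ℝ × ℝ => f (p.1 + p.2)) (by fun_prop)]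
  have hmeas : Measurable (fun p : ℝ × ℝ => (Iic p.2).indicator
      (fun a => ENNReal.ofReal (Real.exp (-(l n * (p.2 - a))))) p.1) := by
    have hs : MeasurableSet {p : ℝ × ℝ | p.1 ≤ p.2} := measurableSet_le measurable_fst measurable_snd
    have : Measurable (fun p : ℝ × ℝ => ENNReal.ofReal (Real.exp (-(l n * (p.2 - p.1))))) := by
      fun_prop
    exact this.indicator hs
  have h2 : ∀ e, ∫⁻ t in Ioi (0 : ℝ), ENNReal.ofReal (l n * Real.exp (-(l n * t))) *
        f (arrival l n e + t) =
      ∫⁻ s, ENNReal.ofReal (l n) * (Iic s).indicator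
        (fun a => ENNReal.ofReal (Real.exp (-(l n * (s - a))))) (arrival l n e) * f s := by
    intro e
    rw [← lintegral_indicator measurableSet_Ioi, ← lintegral_sub_right_eq_self _ (arrival l n e)]
    refine lintegral_congr_ae ?_
    have h0 : ∀ᵐ s : ℝ, s ≠ arrival l n e := by simp [ae_iff]
    filter_upwards [h0] with s hs
    rcases lt_or_gt_of_ne hs with h | h
    · simp [Set.indicator, not_lt.2 h.le, not_le.2 h]
    · simp [Set.indicator, h, h.le, ENNReal.ofReal_mul (hl n).le]
  rw [lintegral_congr h2, lintegral_lintegral_swap]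
  · refine lintegral_congr fun s => ?_
    have hm : Measurable fun e => (Iic s).indicator
        (fun a => ENNReal.ofReal (Real.exp (-(l n * (s - a))))) (arrival l n e) :=
      hmeas.comp ((measurable_arrival l n).prodMk measurable_const)
    rw [lintegral_mul_const _ (hm.const_mul _), lintegral_const_mul _ hm,
      residence_eq_lintegral hl n s]
  · have := hmeas.comp (f := fun q : (ℕ → ℝ) × ℝ => (arrival l n q.1, q.2))
      (((measurable_arrival l n).comp measurable_fst).prodMk measurable_snd)
    exact ((this.const_mul _).mul (hf.comp measurable_snd)).aemeasurable

theorem residence_of_neg {l : ℕ → ℝ} (hl : ∀ i, 0 < l i) (n : ℕ) {t : ℝ} (ht : t < 0) :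
    residence l n t = 0 := by
  have : {e | arrival l n e ≤ t ∧ t < arrival l (n + 1) e} = ∅ := by
    ext e
    simpa using fun h => absurd (arrival_nonneg hl n e) (by linarith)
  rw [residence, this, measure_empty]

theorem residence_succ {l : ℕ → ℝ} (hl : ∀ i, 0 < l i) (n : ℕ) (t : ℝ) :
    residence l (n + 1) t = ∫⁻ s in Icc 0 t, ENNReal.ofReal (l n) * residence l n s *
      ENNReal.ofReal (Real.exp (-(l (n + 1) * (t - s)))) := by
  have hm : Measurable ((Iic t).indicator
      (fun s => ENNReal.ofReal (Real.exp (-(l (n + 1) * (t - s)))))) :=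
    Measurable.indicator (by fun_prop) measurableSet_Iic
  rw [residence_eq_lintegral hl, lintegral_arrival_succ hl n hm,
    ← lintegral_indicator measurableSet_Icc]
  refine lintegral_congr fun s => ?_
  by_cases h0 : 0 ≤ s
  · by_cases h1 : s ≤ t <;> simp [Set.indicator, h0, h1]
  · simp [Set.indicator, h0, residence_of_neg hl n (not_le.1 h0)]

end Exponential

end

noncomputable section

/-! ### The walk and its killed semigroup -/

namespace WeightedGraph

variable {V : Type*} {Γ : WeightedGraph V}

/-- The rate at which the walk jumps. -/
def rate (Γ : WeightedGraph V) (w : WalkType) (z : V) : ℝ := Γ.cond z / Γ.theta w z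

theorem rate_pos (hπ : ∀ x, 0 < Γ.cond x) (w : WalkType) (z : V) : 0 < Γ.rate w z :=
  div_pos (hπ z) (theta_pos hπ w z)

theorem meanHolding_eq (hπ : ∀ x, 0 < Γ.cond x) (w : WalkType) (z : V) :
    Γ.meanHolding w z = ENNReal.ofReal (Γ.rate w z)⁻¹ := by
  cases w
  · simp [meanHolding, rate, theta, div_self (hπ z).ne']
  · simp [meanHolding, rate, theta, ENNReal.ofReal_inv_of_pos (hπ z)]

/-- The jump rates along a trajectory of the jump chain. -/
def pathRate (Γ : WeightedGraph V) (w : WalkType) (Y : ℕ → V) (i : ℕ) : ℝ := Γ.rate w (Y i)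

theorem pathRate_pos (hπ : ∀ x, 0 < Γ.cond x) (w : WalkType) (Y : ℕ → V) (i : ℕ) :
    0 < Γ.pathRate w Y i := rate_pos hπ w _

theorem ofReal_holding (hπ : ∀ x, 0 < Γ.cond x) (w : WalkType) (ω : (ℕ → V) × (ℕ → ℝ)) (n : ℕ) :
    ENNReal.ofReal (ω.2 n) * Γ.meanHolding w (ω.1 n) =
      ENNReal.ofReal (holding (Γ.pathRate w ω.1) n ω.2) := by
  rw [meanHolding_eq hπ, holding, div_eq_mul_inv, ENNReal.ofReal_mul (le_max_right _ _)]
  congr 1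
  rcases le_total (ω.2 n) 0 with h | h
  · rw [max_eq_right h, ENNReal.ofReal_of_nonpos h, ENNReal.ofReal_zero]
  · rw [max_eq_left h]

theorem jumpTime_eq (hπ : ∀ x, 0 < Γ.cond x) (w : WalkType) (ω : (ℕ → V) × (ℕ → ℝ)) (n : ℕ) :
    Γ.jumpTime w ω n = ENNReal.ofReal (arrival (Γ.pathRate w ω.1) n ω.2) := by
  rw [arrival, ENNReal.ofReal_sum_of_nonneg fun i _ => holding_nonneg (pathRate_pos hπ w _) i _]
  exact Finset.sum_congr rfl fun i _ => ofReal_holding hπ w ω i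

theorem jumpTime_mono (w : WalkType) (ω : (ℕ → V) × (ℕ → ℝ)) : Monotone (Γ.jumpTime w ω) :=
  fun _ _ h => Finset.sum_le_sum_of_subset (Finset.range_mono h)

theorem position_eq_some_iff (w : WalkType) (t : ℝ) (ω : (ℕ → V) × (ℕ → ℝ)) (y : V) :
    Γ.position w t ω = some y ↔ ∃ n, Γ.jumpTime w ω n ≤ ENNReal.ofReal t ∧
      ENNReal.ofReal t < Γ.jumpTime w ω (n + 1) ∧ ω.1 n = y := by
  classical
  unfold position
  constructor
  · intro h
    split_ifs at h with hex
    obtain ⟨h1, h2⟩ := Nat.find_spec hex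
    exact ⟨_, h1, h2, by simpa using h⟩
  · rintro ⟨n, h1, h2, h3⟩
    have hex : ∃ n, Γ.jumpTime w ω n ≤ ENNReal.ofReal t ∧
      ENNReal.ofReal t < Γ.jumpTime w ω (n + 1) := ⟨n, h1, h2⟩
    rw [dif_pos hex, ← h3]
    obtain ⟨h4, h5⟩ := Nat.find_spec hex
    have h6 : Nat.find hex = n := by
      refine le_antisymm (Nat.find_min' hex ⟨h1, h2⟩) (not_lt.1 fun hlt => ?_)
      exact absurd (h5.trans_le (jumpTime_mono w ω hlt)) (not_lt.2 h1)
    rw [h6]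

theorem jumpPMF_apply (hfin : ∀ x, {y | 0 < Γ.weight x y}.Finite) (hπ : ∀ x, 0 < Γ.cond x)
    (x y : V) : Γ.jumpPMF x y = ENNReal.ofReal (Γ.weight x y / Γ.cond x) := by
  have hsum : ∑' y, ENNReal.ofReal (Γ.weight x y) = ENNReal.ofReal (Γ.cond x) := by
    rw [tsum_eq_sum (s := (hfin x).toFinset) fun y hy => ?_, cond_eq_sum hfin,
      ENNReal.ofReal_sum_of_nonneg fun y _ => Γ.weight_nonneg x y]
    exact ENNReal.ofReal_of_nonpos (by simpa using hy)
  have h : (∑' y, ENNReal.ofReal (Γ.weight x y)) ≠ 0 ∧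
      (∑' y, ENNReal.ofReal (Γ.weight x y)) ≠ ∞ := by
    rw [hsum]
    exact ⟨by simpa using hπ x, ENNReal.ofReal_ne_top⟩
  rw [jumpPMF, dif_pos h, PMF.normalize_apply, hsum, ← ENNReal.ofReal_inv_of_pos (hπ x),
    ← ENNReal.ofReal_mul (Γ.weight_nonneg x y), div_eq_mul_inv]

/-- Trajectories that stay in `B` up to the `n`-th jump. -/
def stay (B : Finset V) (n : ℕ) : Set (ℕ → V) := {Y | ∀ i ≤ n, Y i ∈ B}

theorem stay_succ (B : Finset V) (n : ℕ) (Y : ℕ → V) :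
    Y ∈ stay B (n + 1) ↔ Y ∈ stay B n ∧ Y (n + 1) ∈ B := by
  constructor
  · exact fun h => ⟨fun i hi => h i (by omega), h _ le_rfl⟩
  · rintro ⟨h1, h2⟩ i hi
    rcases Nat.lt_or_ge n i with h | h
    · rwa [show i = n + 1 by omega]
    · exact h1 i h

theorem stay_congr (B : Finset V) (n : ℕ) {Y Z : ℕ → V} (h : ∀ i ≤ n, Y i = Z i) :
    Y ∈ stay B n ↔ Z ∈ stay B n :=
  forall₂_congr fun i hi => by rw [h i hi]

variable [MeasurableSpace V] [DiscreteMeasurableSpace V]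

theorem measurableSet_stay (B : Finset V) (n : ℕ) : MeasurableSet (stay B n) := by
  have : stay B n = ⋂ i ∈ Finset.range (n + 1), (fun Y : ℕ → V => Y i) ⁻¹' B := by
    ext Y
    simp [stay]
  rw [this]
  exact Finset.measurableSet_biInter _ fun i _ => measurable_pi_apply i (by measurability)

theorem measurableSet_apply_eq (n : ℕ) (z : V) : MeasurableSet {Y : ℕ → V | Y n = z} :=
  (measurableSet_singleton z).preimage (measurable_pi_apply n)

theorem measurable_arrival_pathRate (w : WalkType) (n : ℕ) :
    Measurable fun p : (ℕ → V) × (ℕ → ℝ) => arrival (Γ.pathRate w p.1) n p.2 := by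
  unfold arrival holding pathRate
  refine Finset.measurable_sum _ fun i _ => ?_
  have h1 : Measurable (Γ.rate w) := Measurable.of_discrete
  exact (((measurable_pi_apply i).comp measurable_snd).max measurable_const).div
    (h1.comp ((measurable_pi_apply i).comp measurable_fst))

theorem measurable_residence (w : WalkType) (n : ℕ) :
    Measurable fun p : ℝ × (ℕ → V) => residence (Γ.pathRate w p.2) n p.1 := by
  have h1 : ∀ n, Measurable fun q : (ℝ × (ℕ → V)) × (ℕ → ℝ) =>
      arrival (Γ.pathRate w q.1.2) n q.2 := fun n =>
    (measurable_arrival_pathRate w n).comp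
      ((measurable_snd.comp measurable_fst).prodMk measurable_snd)
  have h2 : Measurable fun q : (ℝ × (ℕ → V)) × (ℕ → ℝ) => q.1.1 :=
    measurable_fst.comp measurable_fst
  exact measurable_measure_prodMk_left
    ((measurableSet_le (h1 n) h2).inter (measurableSet_lt h2 (h1 (n + 1))))

variable [Countable V]

theorem lintegral_jumpLaw_zero (x : V) {F : (ℕ → V) → ℝ≥0∞} (hF : Measurable F)
    (hdep : ∀ Y Z : ℕ → V, Y 0 = Z 0 → F Y = F Z) :
    ∫⁻ Y, F Y ∂Γ.jumpLaw x = F fun _ => x := by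
  rw [jumpLaw, Kernel.lintegral_traj _ hF]
  rw [lintegral_congr (g := fun _ => F fun _ => x) fun Y => hdep _ _ (by
    simp [Function.updateFinset])]
  simp

instance (x : V) : IsProbabilityMeasure (Γ.jumpLaw x) := by
  unfold jumpLaw
  infer_instance

/-- The Markov property of the jump chain at its `n`-th step. -/
theorem lintegral_jumpLaw_succ (x : V) (n : ℕ) {F : (ℕ → V) → ℝ≥0∞} (hF : Measurable F)
    (hdep : ∀ Y Z : ℕ → V, (∀ i ≤ n, Y i = Z i) → F Y = F Z) (z : V) :
    ∫⁻ Y, F Y * {Y : ℕ → V | Y (n + 1) = z}.indicator 1 Y ∂Γ.jumpLaw x =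
      ∫⁻ Y, F Y * Γ.jumpPMF (Y n) z ∂Γ.jumpLaw x := by
  have hset : MeasurableSet {Y : ℕ → V | Y (n + 1) = z} :=
    measurableSet_apply_eq (n + 1) z
  have hp : Measurable fun Y : ℕ → V => Γ.jumpPMF (Y n) z :=
    (Measurable.of_discrete (f := fun v => Γ.jumpPMF v z)).comp (measurable_pi_apply n)
  have hm1 : Measurable fun Y : ℕ → V => F Y * {Y : ℕ → V | Y (n + 1) = z}.indicator 1 Y :=
    hF.mul (measurable_one.indicator hset)
  have hm2 : Measurable fun Y : ℕ → V => F Y * Γ.jumpPMF (Y n) z := hF.mul hp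
  rw [jumpLaw, ← Kernel.traj_comp_partialTraj (Nat.zero_le n), Kernel.lintegral_comp _ _ _ hm1,
    Kernel.lintegral_comp _ _ _ hm2]
  refine lintegral_congr fun h => ?_
  set H : ℕ → V := fun i => if hi : i ∈ Finset.Iic n then h ⟨i, hi⟩ else x with hH
  have hupd : ∀ Y : ℕ → V, ∀ i ≤ n, Function.updateFinset Y (Finset.Iic n) h i = H i := by
    intro Y i hi
    simp [Function.updateFinset, hH, hi]
  rw [Kernel.lintegral_traj _ hm1, Kernel.lintegral_traj _ hm2]
  have e1 : ∀ Y : ℕ → V, F (Function.updateFinset Y (Finset.Iic n) h) *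
      {Y : ℕ → V | Y (n + 1) = z}.indicator 1 (Function.updateFinset Y (Finset.Iic n) h) =
      F H * {Y : ℕ → V | Y (n + 1) = z}.indicator 1 Y := fun Y => by
    have h1 : Function.updateFinset Y (Finset.Iic n) h (n + 1) = Y (n + 1) := by
      rw [Function.updateFinset, dif_neg (by simp)]
    rw [hdep _ H (hupd Y)]
    simp only [Set.indicator, mem_ofPred_eq, h1]
    congr
  have e2 : ∀ Y : ℕ → V, F (Function.updateFinset Y (Finset.Iic n) h) *
      Γ.jumpPMF (Function.updateFinset Y (Finset.Iic n) h n) z =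
      F H * Γ.jumpPMF (H n) z := fun Y => by
    rw [hdep _ H (hupd Y), hupd Y n le_rfl]
  rw [lintegral_congr e1, lintegral_congr e2,
    lintegral_const_mul _ (measurable_one.indicator hset), lintegral_indicator_one hset]
  have e3 : Kernel.traj (X := fun _ => V) (fun n => Γ.stepKernel n) n h
      {Y : ℕ → V | Y (n + 1) = z} = Γ.jumpPMF (H n) z := by
    have h1 := congr_arg (fun κ => κ h {z})
      (Kernel.map_traj_succ_self (X := fun _ => V) (κ := fun n => Γ.stepKernel n) (a := n))
    rw [Kernel.map_apply' _ (measurable_pi_apply _) _ (measurableSet_singleton z)] at h1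
    have h2 : Γ.stepKernel n h {z} = Γ.jumpPMF (H n) z := by
      have h3 : H n = h ⟨n, Finset.mem_Iic.2 le_rfl⟩ := by simp [hH]
      rw [h3]
      exact (Γ.jumpPMF _).toMeasure_apply_singleton z (measurableSet_singleton z)
    rw [← h2, ← h1]
    rfl
  rw [e3]
  simp

end WeightedGraph

end

noncomputable section

section ForwardEquation

variable {ι : Type*} [Fintype ι] {f : ℝ → ι → ℝ} {k : ι → ι → ℝ} {r δ : ι → ℝ}

theorem intervalIntegrable_forward (hm : ∀ y, Measurable fun t => f t y)
    (h0 : ∀ t y, 0 ≤ f t y) (h1 : ∀ t y, f t y ≤ 1) (y : ι) (a b : ℝ) :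
    IntervalIntegrable (fun s => ∑ z, f s z * k z y * Real.exp (r y * s)) volume a b := by
  have hsum : (fun s => ∑ z, f s z * k z y * Real.exp (r y * s)) =
      ∑ z, fun s => f s z * k z y * Real.exp (r y * s) := by
    ext s
    simp
  rw [hsum]
  refine IntervalIntegrable.sum _ fun z _ => ?_
  have h2 : IntervalIntegrable (fun s => f s z) volume a b := by
    refine (intervalIntegrable_const (c := (1 : ℝ))).mono_fun' (hm z).aestronglyMeasurable ?_
    exact Filter.Eventually.of_forall fun s => by
      simpa [abs_of_nonneg (h0 s z)] using h1 s z
  exact (h2.mul_const _).mul_continuousOn (by fun_prop)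

/-- An integrated forward equation can be differentiated. -/
theorem hasDerivAt_of_forward (hm : ∀ y, Measurable fun t => f t y)
    (h0 : ∀ t y, 0 ≤ f t y) (h1 : ∀ t y, f t y ≤ 1)
    (heq : ∀ t, 0 ≤ t → ∀ y, f t y = δ y * Real.exp (-(r y * t)) +
      ∫ s in (0 : ℝ)..t, ∑ z, f s z * k z y * Real.exp (-(r y * (t - s)))) (y : ι) :
    ContinuousOn (fun t => f t y) (Ici 0) ∧
      ∀ t, 0 < t → HasDerivAt (fun t => f t y) (∑ z, f t z * k z y - r y * f t y) t := by
  set g : ι → ℝ → ℝ := fun y t => ∫ s in (0 : ℝ)..t, ∑ z, f s z * k z y * Real.exp (r y * s) with hg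
  have hfg : ∀ t, 0 ≤ t → ∀ y, f t y = Real.exp (-(r y * t)) * (δ y + g y t) := by
    intro t ht y
    rw [heq t ht y, mul_add, hg, ← intervalIntegral.integral_const_mul, mul_comm (δ y)]
    congr 1
    refine intervalIntegral.integral_congr fun s _ => ?_
    simp only [Finset.mul_sum]
    refine Finset.sum_congr rfl fun z _ => ?_
    rw [show -(r y * (t - s)) = -(r y * t) + r y * s by ring, Real.exp_add]
    ring
  have hgc : ∀ y, Continuous (g y) := fun y =>
    intervalIntegral.continuous_primitive (intervalIntegrable_forward hm h0 h1 y) 0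
  have hfc : ∀ y, ContinuousOn (fun t => f t y) (Ici 0) := fun y => by
    refine ContinuousOn.congr (f := fun t => Real.exp (-(r y * t)) * (δ y + g y t)) ?_
      fun t ht => hfg t ht y
    have := hgc y
    fun_prop
  refine ⟨hfc y, fun t ht => ?_⟩
  have hgd : HasDerivAt (g y) (∑ z, f t z * k z y * Real.exp (r y * t)) t := by
    refine intervalIntegral.integral_hasDerivAt_right (intervalIntegrable_forward hm h0 h1 y 0 t)
      ?_ ?_
    · refine (Measurable.stronglyMeasurable ?_).stronglyMeasurableAtFilter
      have := hm
      fun_prop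
    · have : ∀ z, ContinuousAt (fun t => f t z) t := fun z =>
        (hfc z).continuousAt (Ici_mem_nhds ht)
      fun_prop
  have he : HasDerivAt (fun t => Real.exp (-(r y * t))) (Real.exp (-(r y * t)) * -(r y)) t := by
    have := ((hasDerivAt_id t).const_mul (r y)).neg.exp
    simpa using this
  have hprod := he.mul (hgd.const_add (δ y))
  have hev : (fun t => f t y) =ᶠ[nhds t] fun t => Real.exp (-(r y * t)) * (δ y + g y t) := by
    filter_upwards [Ioi_mem_nhds ht] with s hs
    exact hfg s (le_of_lt hs) y
  refine (HasDerivAt.congr_deriv hprod ?_).congr_of_eventuallyEq hev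
  have hexp : Real.exp (-(r y * t)) * Real.exp (r y * t) = 1 := by
    rw [← Real.exp_add]; simp
  rw [hfg t ht.le y, ← Finset.sum_mul]
  linear_combination (∑ z, f t z * k z y) * hexp

end ForwardEquation

theorem residence_congr {l l' : ℕ → ℝ} (n : ℕ) (t : ℝ) (h : ∀ i ≤ n, l i = l' i) :
    residence l n t = residence l' n t := by
  have h1 : ∀ m ≤ n + 1, ∀ e, arrival l m e = arrival l' m e := fun m hm e =>
    Finset.sum_congr rfl fun i hi => by
      have := Finset.mem_range.1 hi
      rw [holding, holding, h i (by omega)]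
  simp only [residence, h1 n (by omega), h1 (n + 1) le_rfl]

namespace WeightedGraph

variable {V : Type*} {Γ : WeightedGraph V}

theorem stay_mul_eq_sum (B : Finset V) (n : ℕ) (φ : V → ℝ≥0∞) (Y : ℕ → V) :
    (stay B n).indicator 1 Y * φ (Y n) =
      ∑ z ∈ B, (stay B n).indicator 1 Y * {Y : ℕ → V | Y n = z}.indicator 1 Y * φ z := by
  by_cases h : Y ∈ stay B n
  · rw [Finset.sum_eq_single (Y n)]
    · simp
    · intro z _ hz
      simp [Set.indicator, Ne.symm hz]
    · intro h'
      exact absurd (h n le_rfl) h'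
  · simp [h]

theorem ofReal_rate_mul_jumpPMF (hfin : ∀ x, {y | 0 < Γ.weight x y}.Finite)
    (hπ : ∀ x, 0 < Γ.cond x) (w : WalkType) (z y : V) :
    ENNReal.ofReal (Γ.rate w z) * Γ.jumpPMF z y = ENNReal.ofReal (Γ.weight z y / Γ.theta w z) := by
  rw [jumpPMF_apply hfin hπ, ← ENNReal.ofReal_mul (rate_pos hπ w z).le, rate]
  congr 1
  have h1 := (hπ z).ne'
  have h2 := (theta_pos hπ w z).ne'
  field_simp

variable [MeasurableSpace V] [DiscreteMeasurableSpace V]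

theorem measurable_stay_indicator (B : Finset V) (n : ℕ) :
    Measurable fun Y : ℕ → V => (stay B n).indicator (1 : (ℕ → V) → ℝ≥0∞) Y :=
  measurable_one.indicator (measurableSet_stay B n)

theorem measurable_apply_indicator (n : ℕ) (y : V) :
    Measurable fun Y : ℕ → V => {Y : ℕ → V | Y n = y}.indicator (1 : (ℕ → V) → ℝ≥0∞) Y :=
  measurable_one.indicator (measurableSet_apply_eq n y)

theorem measurable_residence_right (w : WalkType) (n : ℕ) (t : ℝ) :
    Measurable fun Y : ℕ → V => residence (Γ.pathRate w Y) n t := by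
  have h := (measurable_residence (Γ := Γ) w n).comp
    (measurable_prodMk_left (x := t) (β := ℕ → V))
  exact h

variable [Countable V]

/-- The probability that the walk sits at `y` at time `t`, after exactly `n` jumps in `B`. -/
def occupation (Γ : WeightedGraph V) (w : WalkType) (B : Finset V) (x : V) (n : ℕ) (t : ℝ) (y : V) :
    ℝ≥0∞ :=
  ∫⁻ Y, (stay B n).indicator 1 Y * {Y : ℕ → V | Y n = y}.indicator 1 Y *
    residence (Γ.pathRate w Y) n t ∂Γ.jumpLaw x

theorem measurable_occupation (w : WalkType) (B : Finset V) (x : V) (n : ℕ) (y : V) :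
    Measurable fun t => Γ.occupation w B x n t y := by
  have h1 : Measurable fun p : ℝ × (ℕ → V) => (stay B n).indicator (1 : (ℕ → V) → ℝ≥0∞) p.2 *
      {Y : ℕ → V | Y n = y}.indicator 1 p.2 * residence (Γ.pathRate w p.2) n p.1 :=
    (((measurable_stay_indicator B n).comp measurable_snd).mul
      ((measurable_apply_indicator n y).comp measurable_snd)).mul (measurable_residence w n)
  exact h1.lintegral_prod_right'

open Classical in
theorem occupation_zero (hπ : ∀ x, 0 < Γ.cond x) (w : WalkType) {B : Finset V} {x : V}
    (hx : x ∈ B) {t : ℝ} (ht : 0 ≤ t) (y : V) :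
    Γ.occupation w B x 0 t y =
      if x = y then ENNReal.ofReal (Real.exp (-(Γ.rate w y * t))) else 0 := by
  have hm : Measurable fun Y : ℕ → V => (stay B 0).indicator (1 : (ℕ → V) → ℝ≥0∞) Y *
      {Y : ℕ → V | Y 0 = y}.indicator 1 Y * residence (Γ.pathRate w Y) 0 t :=
    ((measurable_stay_indicator B 0).mul (measurable_apply_indicator 0 y)).mul
      (measurable_residence_right w 0 t)
  refine (lintegral_jumpLaw_zero x hm ?_).trans ?_
  rotate_left
  · have h1 : (fun _ => x) ∈ stay B 0 := fun i _ => hx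
    simp only [residence_zero (pathRate_pos hπ w _) ht, Set.indicator_of_mem h1]
    by_cases h : x = y
    · simp [h, pathRate]
    · simp [h]
  · intro Y Z hYZ
    have h1 : ∀ i ≤ 0, Y i = Z i := fun i hi => by rwa [Nat.le_zero.1 hi]
    have h2 := stay_congr B 0 h1
    rw [residence_congr 0 t (l' := Γ.pathRate w Z) fun i hi => by rw [pathRate, pathRate, h1 i hi]]
    by_cases h3 : Y ∈ stay B 0
    · simp [h3, h2.1 h3, Set.indicator, hYZ]
    · simp [h3, mt h2.2 h3]

theorem occupation_succ (hfin : ∀ x, {y | 0 < Γ.weight x y}.Finite)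
    (hπ : ∀ x, 0 < Γ.cond x) (w : WalkType) {B : Finset V} (x : V) (n : ℕ) (t : ℝ) {y : V}
    (hy : y ∈ B) :
    Γ.occupation w B x (n + 1) t y = ∫⁻ s in Icc 0 t, ∑ z ∈ B, Γ.occupation w B x n s z *
      ENNReal.ofReal (Γ.weight z y / Γ.theta w z) *
      ENNReal.ofReal (Real.exp (-(Γ.rate w y * (t - s)))) := by
  set E : ℝ → ℝ≥0∞ := fun s => ENNReal.ofReal (Real.exp (-(Γ.rate w y * (t - s)))) with hE
  have hEm : Measurable E := by simp only [hE]; fun_prop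
  set H : ℝ → (ℕ → V) → ℝ≥0∞ := fun s Y =>
    ENNReal.ofReal (Γ.rate w (Y n)) * residence (Γ.pathRate w Y) n s * E s with hH
  have hrate : Measurable fun Y : ℕ → V => ENNReal.ofReal (Γ.rate w (Y n)) :=
    (Measurable.of_discrete (f := fun v => ENNReal.ofReal (Γ.rate w v))).comp
      (measurable_pi_apply n)
  have hHm : Measurable fun p : ℝ × (ℕ → V) => H p.1 p.2 :=
    ((hrate.comp measurable_snd).mul (measurable_residence w n)).mul (hEm.comp measurable_fst)
  set F : (ℕ → V) → ℝ≥0∞ := fun Y =>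
    (stay B n).indicator 1 Y * ∫⁻ s in Icc 0 t, H s Y with hF
  have hFm : Measurable F := by
    refine (measurable_stay_indicator B n).mul ?_
    exact Measurable.lintegral_prod_left' (μ := volume.restrict (Icc 0 t)) hHm
  have e1 : ∀ Y : ℕ → V, (stay B (n + 1)).indicator 1 Y * {Y : ℕ → V | Y (n + 1) = y}.indicator 1 Y *
      residence (Γ.pathRate w Y) (n + 1) t = F Y * {Y : ℕ → V | Y (n + 1) = y}.indicator 1 Y := by
    intro Y
    by_cases hYy : Y (n + 1) = y
    · have h1 : {Y : ℕ → V | Y (n + 1) = y}.indicator (1 : (ℕ → V) → ℝ≥0∞) Y = 1 := by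
        simp [Set.indicator, hYy]
      have h2 : (stay B (n + 1)).indicator (1 : (ℕ → V) → ℝ≥0∞) Y = (stay B n).indicator 1 Y := by
        have : Y ∈ stay B (n + 1) ↔ Y ∈ stay B n := by
          rw [stay_succ]
          exact and_iff_left (hYy ▸ hy)
        by_cases h : Y ∈ stay B n
        · simp [h, this.2 h]
        · simp [h, mt this.1 h]
      rw [h1, h2, residence_succ (pathRate_pos hπ w Y), mul_one, mul_one, hF]
      simp only [hH, hE, pathRate, hYy]
    · simp [Set.indicator, hYy]
  have e2 : ∀ Y Z : ℕ → V, (∀ i ≤ n, Y i = Z i) → F Y = F Z := by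
    intro Y Z h
    have h1 : ∀ s, H s Y = H s Z := fun s => by
      simp only [hH]
      rw [h n le_rfl, residence_congr n s (l' := Γ.pathRate w Z) fun i hi => by
        rw [pathRate, pathRate, h i hi]]
    have h2 := stay_congr B n h
    simp only [hF, h1]
    by_cases h3 : Y ∈ stay B n
    · simp [h3, h2.1 h3]
    · simp [h3, mt h2.2 h3]
  have hp : Measurable fun Y : ℕ → V => Γ.jumpPMF (Y n) y :=
    (Measurable.of_discrete (f := fun v => Γ.jumpPMF v y)).comp (measurable_pi_apply n)
  have e3 : ∀ Y, F Y * Γ.jumpPMF (Y n) y =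
      ∫⁻ s in Icc 0 t, (stay B n).indicator 1 Y * H s Y * Γ.jumpPMF (Y n) y := by
    intro Y
    have h1 : Measurable fun s => H s Y := hHm.comp (measurable_id.prodMk measurable_const)
    rw [lintegral_mul_const _ (h1.const_mul _), lintegral_const_mul _ h1]
  have e4 : ∀ s Y, (stay B n).indicator 1 Y * H s Y * Γ.jumpPMF (Y n) y =
      ∑ z ∈ B, ((stay B n).indicator 1 Y * {Y : ℕ → V | Y n = z}.indicator 1 Y *
        residence (Γ.pathRate w Y) n s) * (ENNReal.ofReal (Γ.weight z y / Γ.theta w z) * E s) := by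
    intro s Y
    have h1 := stay_mul_eq_sum B n (fun z => ENNReal.ofReal (Γ.weight z y / Γ.theta w z)) Y
    calc _ = ((stay B n).indicator 1 Y * (ENNReal.ofReal (Γ.rate w (Y n)) * Γ.jumpPMF (Y n) y)) *
          (residence (Γ.pathRate w Y) n s * E s) := by simp only [hH]; ring
      _ = _ := by
        rw [ofReal_rate_mul_jumpPMF hfin hπ, h1, Finset.sum_mul]
        exact Finset.sum_congr rfl fun z _ => by ring
  have hres : ∀ s, Measurable fun Y : ℕ → V => residence (Γ.pathRate w Y) n s :=
    measurable_residence_right w n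
  rw [occupation, lintegral_congr e1, lintegral_jumpLaw_succ x n hFm e2 y, lintegral_congr e3,
    lintegral_lintegral_swap]
  · refine lintegral_congr fun s => ?_
    rw [lintegral_congr (e4 s), lintegral_finsetSum]
    · refine Finset.sum_congr rfl fun z _ => ?_
      rw [lintegral_mul_const, ← mul_assoc]
      · rfl
      · exact ((measurable_stay_indicator B n).mul (measurable_apply_indicator n z)).mul (hres s)
    · intro z _
      exact (((measurable_stay_indicator B n).mul (measurable_apply_indicator n z)).mul
        (hres s)).mul_const _
  · refine Measurable.aemeasurable ?_
    exact (((measurable_stay_indicator B n).comp measurable_fst).mul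
      (hHm.comp measurable_swap)).mul (hp.comp measurable_fst)

theorem tsum_occupation_le (hπ : ∀ x, 0 < Γ.cond x) (w : WalkType) (B : Finset V) (x : V)
    {t : ℝ} (ht : 0 ≤ t) (y : V) :
    ∑' n, Γ.occupation w B x n t y ≤ Γ.walkLaw x {ω | Γ.position w t ω = some y} := by
  set S : ℕ → Set ((ℕ → V) × (ℕ → ℝ)) := fun n => {ω | (ω.1 ∈ stay B n ∧ ω.1 n = y) ∧
    arrival (Γ.pathRate w ω.1) n ω.2 ≤ t ∧ t < arrival (Γ.pathRate w ω.1) (n + 1) ω.2} with hS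
  have hSm : ∀ n, MeasurableSet (S n) := fun n =>
    (((measurableSet_stay B n).inter (measurableSet_apply_eq n y)).preimage measurable_fst).inter
      ((measurableSet_le (measurable_arrival_pathRate w n) measurable_const).inter
        (measurableSet_lt measurable_const (measurable_arrival_pathRate w (n + 1))))
  have hocc : ∀ n, Γ.occupation w B x n t y = Γ.walkLaw x (S n) := by
    intro n
    change _ = ((Γ.jumpLaw x).prod expSequence) (S n)
    rw [Measure.prod_apply (hSm n), occupation]
    refine lintegral_congr fun Y => ?_
    by_cases h : Y ∈ stay B n ∧ Y n = y
    · have h1 : Prod.mk Y ⁻¹' S n = {e | arrival (Γ.pathRate w Y) n e ≤ t ∧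
          t < arrival (Γ.pathRate w Y) (n + 1) e} := by
        ext e; simp [hS, h]
      rw [h1]
      simp [Set.indicator, h, residence]
    · have h1 : Prod.mk Y ⁻¹' S n = ∅ := by
        ext e; simp only [hS, mem_preimage, mem_ofPred_eq, h, false_and]; rfl
      rw [h1, measure_empty]
      rw [not_and_or] at h
      rcases h with h | h <;> simp [Set.indicator, h]
  have hdisj : Pairwise (Function.onFun Disjoint S) := by
    have hmono : ∀ ω : (ℕ → V) × (ℕ → ℝ), Monotone fun n => arrival (Γ.pathRate w ω.1) n ω.2 :=
      fun ω => monotone_nat_of_le_succ fun n => by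
        simp only [arrival, Finset.sum_range_succ]
        linarith [holding_nonneg (pathRate_pos hπ w ω.1) n ω.2]
    have key : ∀ m n, m < n → Disjoint (S m) (S n) := by
      intro m n hmn
      refine Set.disjoint_left.2 fun ω h1 h2 => ?_
      exact absurd (h1.2.2.trans_le (hmono ω hmn)) (not_lt.2 h2.2.1)
    intro m n hmn
    rcases lt_or_gt_of_ne hmn with h | h
    · exact key m n h
    · exact (key n m h).symm
  rw [tsum_congr hocc, ← measure_iUnion hdisj hSm]
  refine measure_mono (iUnion_subset fun n ω hω => ?_)
  refine (position_eq_some_iff w t ω y).2 ⟨n, ?_, ?_, hω.1.2⟩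
  · rw [jumpTime_eq hπ]
    exact ENNReal.ofReal_le_ofReal hω.2.1
  · rw [jumpTime_eq hπ]
    exact (ENNReal.ofReal_lt_ofReal_iff_of_nonneg ht).2 hω.2.2

end WeightedGraph

end

noncomputable section

namespace WeightedGraph

open Matrix

variable {V : Type*} {Γ : WeightedGraph V}

/-- The exit time is at most the sum of the holding times before the exit. -/
theorem exitTime_le (hπ : ∀ x, 0 < Γ.cond x) (w : WalkType) (B : Finset V)
    {ω : (ℕ → V) × (ℕ → ℝ)} (hω : ∀ n, 0 < ω.2 n) :
    Γ.exitTime w B ω ≤ ∑' n, (stay B n).indicator 1 ω.1 *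
      (ENNReal.ofReal (ω.2 n) * Γ.meanHolding w (ω.1 n)) := by
  classical
  set T := ∑' n, (stay B n).indicator 1 ω.1 *
    (ENNReal.ofReal (ω.2 n) * Γ.meanHolding w (ω.1 n)) with hT
  by_cases hTtop : T = ∞
  · rw [hTtop]; exact le_top
  have key : ∀ y ∈ (B : Set V), Γ.position w (T.toNNReal : ℝ) ω ≠ some y := by
    intro y hy hpos
    obtain ⟨n, h1, h2, h3⟩ := (position_eq_some_iff w _ ω y).1 hpos
    have hTr : ENNReal.ofReal ((T.toNNReal : ℝ)) = T := by
      rw [ENNReal.ofReal_coe_nnreal, ENNReal.coe_toNNReal hTtop]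
    rw [hTr] at h1 h2
    by_cases hst : ω.1 ∈ stay B n
    · refine absurd h2 (not_lt.2 ?_)
      rw [jumpTime, hT]
      refine le_trans (Finset.sum_le_sum fun i hi => ?_)
        (ENNReal.sum_le_tsum (Finset.range (n + 1)))
      have : ω.1 ∈ stay B i := fun j hj => hst j (by have := Finset.mem_range.1 hi; omega)
      rw [Set.indicator_of_mem this, Pi.one_apply, one_mul]
    · have hex : ∃ i, ω.1 i ∉ B := by
        by_contra! h
        exact hst fun i _ => h i
      have hNn : Nat.find hex < n := by
        by_contra! hle
        have hlt : ∀ i ≤ n, ω.1 i ∈ B := fun i hi => by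
          rcases lt_or_eq_of_le (hi.trans hle) with h | h
          · by_contra hi'
            exact absurd (Nat.find_min' hex hi') (not_le.2 h)
          · have : i = n := le_antisymm hi (h ▸ hle)
            rw [this, h3]
            exact hy
        exact hst hlt
      have hTeq : T = Γ.jumpTime w ω (Nat.find hex) := by
        rw [hT, jumpTime, tsum_eq_sum (s := Finset.range (Nat.find hex))]
        · refine Finset.sum_congr rfl fun i hi => ?_
          have : ω.1 ∈ stay B i := fun j hj => by
            by_contra hj'
            have h4 := Nat.find_min' hex hj'
            have h5 := Finset.mem_range.1 hi
            omega
          rw [Set.indicator_of_mem this, Pi.one_apply, one_mul]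
        · intro i hi
          have : ω.1 ∉ stay B i := fun h =>
            Nat.find_spec hex (h _ (by simpa using hi))
          rw [Set.indicator_of_notMem this, zero_mul]
      have h6 : Γ.jumpTime w ω (Nat.find hex) < Γ.jumpTime w ω (Nat.find hex + 1) := by
        rw [jumpTime_eq hπ, jumpTime_eq hπ,
          ENNReal.ofReal_lt_ofReal_iff_of_nonneg (arrival_nonneg (pathRate_pos hπ w _) _ _)]
        simp only [arrival, Finset.sum_range_succ]
        have : 0 < holding (Γ.pathRate w ω.1) (Nat.find hex) ω.2 :=
          div_pos (lt_max_of_lt_left (hω _)) (pathRate_pos hπ w _ _)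
        linarith
      have h7 := h6.trans_le (jumpTime_mono w ω hNn)
      exact absurd (h1.trans_eq hTeq) (not_le.2 h7)
  calc Γ.exitTime w B ω ≤ (T.toNNReal : ℝ≥0∞) := iInf₂_le T.toNNReal key
    _ = T := ENNReal.coe_toNNReal hTtop

variable [Countable V] [MeasurableSpace V] [DiscreteMeasurableSpace V]

instance (x : V) : IsProbabilityMeasure (Γ.walkLaw x) := by
  change IsProbabilityMeasure ((Γ.jumpLaw x).prod expSequence)
  infer_instance

theorem tsum_occupation_le_one (hπ : ∀ x, 0 < Γ.cond x) (w : WalkType) (B : Finset V) (x : V)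
    {t : ℝ} (ht : 0 ≤ t) (y : V) : ∑' n, Γ.occupation w B x n t y ≤ 1 :=
  (tsum_occupation_le hπ w B x ht y).trans prob_le_one

open Classical in
theorem tsum_occupation_eq (hfin : ∀ x, {y | 0 < Γ.weight x y}.Finite)
    (hπ : ∀ x, 0 < Γ.cond x) (w : WalkType) {B : Finset V} {x : V} (hx : x ∈ B)
    {t : ℝ} (ht : 0 ≤ t) {y : V} (hy : y ∈ B) :
    ∑' n, Γ.occupation w B x n t y =
      (if x = y then ENNReal.ofReal (Real.exp (-(Γ.rate w y * t))) else 0) +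
      ∫⁻ s in Icc 0 t, ∑ z ∈ B, (∑' n, Γ.occupation w B x n s z) *
        ENNReal.ofReal (Γ.weight z y / Γ.theta w z) *
        ENNReal.ofReal (Real.exp (-(Γ.rate w y * (t - s)))) := by
  have hE : Measurable fun s => ENNReal.ofReal (Real.exp (-(Γ.rate w y * (t - s)))) := by fun_prop
  rw [tsum_eq_zero_add' ENNReal.summable, occupation_zero hπ w hx ht y]
  congr 1
  rw [tsum_congr fun n => occupation_succ hfin hπ w x n t hy, ← lintegral_tsum]
  · refine lintegral_congr fun s => ?_
    rw [Summable.tsum_finsetSum fun _ _ => ENNReal.summable]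
    refine Finset.sum_congr rfl fun z _ => ?_
    rw [ENNReal.tsum_mul_right, ENNReal.tsum_mul_right]
  · intro n
    refine (Finset.measurable_sum _ fun z _ => ?_).aemeasurable
    exact ((measurable_occupation w B x n z).mul_const _).mul hE

/-- The heat kernel dominates the heat kernel of the killed walk. -/
theorem killedKernel_le_heatKernel (hfin : ∀ x, {y | 0 < Γ.weight x y}.Finite)
    (hπ : ∀ x, 0 < Γ.cond x) (w : WalkType) {B : Finset V} {x y : V} (hx : x ∈ B) (hy : y ∈ B)
    {t : ℝ} (ht : 0 ≤ t) : Γ.killedKernel w B t x y ≤ Γ.heatKernel w t x y := by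
  classical
  have hK := isSubMarkov_killedGenerator hfin hπ w B
  set F : ℝ → B → ℝ≥0∞ := fun s z => ∑' n, Γ.occupation w B x n (max s 0) z with hF
  have hF1 : ∀ s z, F s z ≤ 1 := fun s z =>
    tsum_occupation_le_one hπ w B x (le_max_right _ _) z
  have hFt : ∀ s z, F s z ≠ ∞ := fun s z => ((hF1 s z).trans_lt ENNReal.one_lt_top).ne
  have hFm : ∀ z, Measurable fun s => F s z := fun z =>
    Measurable.tsum fun n => (measurable_occupation w B x n z).comp
      (measurable_id.max measurable_const)
  set f : ℝ → B → ℝ := fun s z => (F s z).toReal with hf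
  have hfm : ∀ z, Measurable fun s => f s z := fun z => (hFm z).ennreal_toReal
  have hf0 : ∀ s z, 0 ≤ f s z := fun s z => ENNReal.toReal_nonneg
  have hf1 : ∀ s z, f s z ≤ 1 := fun s z => by
    have := ENNReal.toReal_mono ENNReal.one_ne_top (hF1 s z)
    simpa using this
  have hk0 : ∀ z y : V, 0 ≤ Γ.weight z y / Γ.theta w z := fun z y =>
    div_nonneg (Γ.weight_nonneg _ _) (theta_nonneg w _)
  have heq : ∀ s, 0 ≤ s → ∀ y : B, f s y =
      (if (⟨x, hx⟩ : B) = y then 1 else 0) * Real.exp (-(Γ.rate w y * s)) +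
      ∫ a in (0 : ℝ)..s, ∑ z : B, f a z * (Γ.weight z y / Γ.theta w z) *
        Real.exp (-(Γ.rate w y * (s - a))) := by
    intro s hs y
    have h1 := tsum_occupation_eq hfin hπ w hx hs y.2
    have h2 : F s y = ∑' n, Γ.occupation w B x n s y := by simp only [hF, max_eq_left hs]
    have h3 : ∫⁻ a in Icc 0 s, ∑ z ∈ B, (∑' n, Γ.occupation w B x n a z) *
        ENNReal.ofReal (Γ.weight z y / Γ.theta w z) *
        ENNReal.ofReal (Real.exp (-(Γ.rate w y * (s - a)))) =
        ∫⁻ a in Icc 0 s, ENNReal.ofReal (∑ z : B, f a z * (Γ.weight z y / Γ.theta w z) *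
          Real.exp (-(Γ.rate w y * (s - a)))) := by
      refine setLIntegral_congr_fun measurableSet_Icc fun a ha => ?_
      rw [ENNReal.ofReal_sum_of_nonneg fun z _ =>
        mul_nonneg (mul_nonneg (hf0 a z) (hk0 z y)) (Real.exp_pos _).le]
      rw [← Finset.sum_coe_sort B]
      refine Finset.sum_congr rfl fun z _ => ?_
      rw [ENNReal.ofReal_mul (mul_nonneg (hf0 a z) (hk0 z y)), ENNReal.ofReal_mul (hf0 a z),
        hf, ENNReal.ofReal_toReal (hFt a z)]
      simp only [hF, max_eq_left ha.1]
    have hint2 : IntegrableOn (fun a => ∑ z : B, f a z * (Γ.weight z y / Γ.theta w z) *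
        Real.exp (-(Γ.rate w y * (s - a)))) (Icc 0 s) := by
      have h := intervalIntegrable_forward (ι := B) (r := fun _ => Γ.rate w y)
        (k := fun z _ => Γ.weight z y / Γ.theta w z) hfm hf0 hf1 y 0 s
      have h' := (h.const_mul (Real.exp (-(Γ.rate w y * s))))
      rw [intervalIntegrable_iff_integrableOn_Icc_of_le hs] at h'
      refine h'.congr_fun (fun a _ => ?_) measurableSet_Icc
      simp only [Finset.mul_sum]
      refine Finset.sum_congr rfl fun z _ => ?_
      rw [show -(Γ.rate w y * (s - a)) = -(Γ.rate w y * s) + Γ.rate w y * a by ring, Real.exp_add]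
      ring
    rw [h3, ← ofReal_integral_eq_lintegral_ofReal hint2 (Filter.Eventually.of_forall fun a =>
      Finset.sum_nonneg fun z _ => mul_nonneg (mul_nonneg (hf0 a z) (hk0 z y)) (Real.exp_pos _).le),
      ← h2, integral_Icc_eq_integral_Ioc, ← intervalIntegral.integral_of_le hs] at h1
    have h4 : 0 ≤ ∫ a in (0 : ℝ)..s, ∑ z : B, f a z * (Γ.weight z y / Γ.theta w z) *
        Real.exp (-(Γ.rate w y * (s - a))) :=
      intervalIntegral.integral_nonneg hs fun a _ => Finset.sum_nonneg fun z _ =>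
        mul_nonneg (mul_nonneg (hf0 a z) (hk0 z y)) (Real.exp_pos _).le
    rw [hf]
    simp only
    rw [h1, ENNReal.toReal_add (by split_ifs <;> simp) ENNReal.ofReal_ne_top,
      ENNReal.toReal_ofReal h4]
    congr 1
    by_cases hxy : x = y
    · have : (⟨x, hx⟩ : B) = y := Subtype.ext hxy
      rw [if_pos hxy, if_pos this, one_mul, ENNReal.toReal_ofReal (Real.exp_pos _).le]
    · have : (⟨x, hx⟩ : B) ≠ y := fun h => hxy (congr_arg Subtype.val h)
      rw [if_neg hxy, if_neg this, zero_mul, ENNReal.toReal_zero]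
  have hder := hasDerivAt_of_forward (r := fun y : B => Γ.rate w y)
    (δ := fun y : B => if (⟨x, hx⟩ : B) = y then 1 else 0)
    (k := fun z y : B => Γ.weight z y / Γ.theta w z) hfm hf0 hf1 heq
  have hcmp := hK.semigroup_le_supersolution (v := fun s z => f s z / Γ.theta w z)
    (v' := fun s y => (∑ z : B, f s z * (Γ.weight z y / Γ.theta w z) -
      Γ.rate w y * f s y) / Γ.theta w y) ht
    (fun z => ((hder z).1.mono Icc_subset_Ici_self).div_const _)
    (fun s hs z => ((hder z).2 s hs.1).div_const _)
    (fun s _ z => by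
      rw [killedGenerator_mulVec]
      refine le_of_eq ?_
      have h1 : ∑ y : B, Γ.weight z y * (f s y / Γ.theta w y) =
          ∑ y : B, f s y * (Γ.weight y z / Γ.theta w y) :=
        Finset.sum_congr rfl fun y _ => by rw [Γ.weight_symm]; ring
      rw [h1, rate]
      ring) ⟨y, hy⟩
  have hinit : (fun z : B => f 0 z / Γ.theta w z) =
      fun z => (if (⟨x, hx⟩ : B) = z then 1 else 0) / Γ.theta w z := by
    ext z
    rw [heq 0 le_rfl z]
    simp
  have hP : (semigroup (Γ.killedGenerator w B) (t - 0) *ᵥ fun z : B => f 0 z / Γ.theta w z) ⟨y, hy⟩ =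
      Γ.killedKernel w B t x y := by
    rw [hinit, killedKernel_symm hfin hπ]
    have h := killedKernel_coe (Γ := Γ) w B t ⟨y, hy⟩ ⟨x, hx⟩
    simp only at h
    rw [h, sub_zero]
    simp only [mulVec, dotProduct]
    rw [Finset.sum_eq_single ⟨x, hx⟩]
    · simp [div_eq_mul_inv]
    · intro z _ hz
      simp [Ne.symm hz]
    · intro h
      exact absurd (Finset.mem_univ _) h
  rw [hP] at hcmp
  refine hcmp.trans ?_
  unfold heatKernel
  refine div_le_div_of_nonneg_right ?_ (theta_nonneg w y)
  have h := tsum_occupation_le hπ w B x ht y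
  simp only [hf, hF, max_eq_left ht]
  exact ENNReal.toReal_mono (measure_ne_top _ _) h

theorem ae_expSequence_pos : ∀ᵐ e ∂expSequence, ∀ n, 0 < e n := by
  rw [ae_all_iff]
  intro n
  have h := measurePreserving_eval_infinitePi (fun _ : ℕ => expMeasure 1) n
  have h1 : ∀ᵐ a ∂expMeasure 1, 0 < a := by
    rw [ae_iff]
    have hs : MeasurableSet {a : ℝ | ¬ 0 < a} := by measurability
    rw [← lintegral_indicator_one hs, lintegral_expMeasure_one (measurable_one.indicator hs),
      setLIntegral_congr_fun (g := fun _ => 0) measurableSet_Ioi fun a ha => ?_]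
    · simp
    · simp [Set.indicator, not_le.2 (show (0 : ℝ) < a from ha)]
  exact h.quasiMeasurePreserving.ae h1

theorem meanExitTime_le_tsum (hπ : ∀ x, 0 < Γ.cond x) (w : WalkType) (B : Finset V) (x : V) :
    Γ.meanExitTime w x B ≤ ∑' n, ∫⁻ Y, (stay B n).indicator 1 Y * Γ.meanHolding w (Y n)
      ∂Γ.jumpLaw x := by
  have hmean : ∀ n, Measurable fun Y : ℕ → V => Γ.meanHolding w (Y n) := fun n =>
    (Measurable.of_discrete (f := Γ.meanHolding w)).comp (measurable_pi_apply n)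
  have hm : ∀ n, Measurable fun ω : (ℕ → V) × (ℕ → ℝ) => (stay B n).indicator 1 ω.1 *
      (ENNReal.ofReal (ω.2 n) * Γ.meanHolding w (ω.1 n)) := fun n =>
    ((measurable_stay_indicator B n).comp measurable_fst).mul
      ((((measurable_pi_apply n).comp measurable_snd).ennreal_ofReal).mul
        ((hmean n).comp measurable_fst))
  have hae : ∀ᵐ ω ∂(Γ.jumpLaw x).prod expSequence, ∀ n, 0 < ω.2 n :=
    Measure.quasiMeasurePreserving_snd.ae ae_expSequence_pos
  change ∫⁻ ω, Γ.exitTime w B ω ∂((Γ.jumpLaw x).prod expSequence) ≤ _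
  refine (lintegral_mono_ae (hae.mono fun ω hω => exitTime_le hπ w B hω)).trans (le_of_eq ?_)
  rw [lintegral_tsum fun n => (hm n).aemeasurable]
  refine tsum_congr fun n => ?_
  rw [lintegral_prod _ (hm n).aemeasurable]
  refine lintegral_congr fun Y => ?_
  have h1 : ∫⁻ e, ENNReal.ofReal (e n) ∂expSequence = 1 := by
    have h := (measurePreserving_eval_infinitePi (fun _ : ℕ => expMeasure 1) n).lintegral_comp
      (f := fun a => ENNReal.ofReal a) (by fun_prop)
    exact h.trans lintegral_ofReal_expMeasure_one
  have h2 : Measurable fun e : ℕ → ℝ => ENNReal.ofReal (e n) := by fun_prop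
  simp only
  rw [lintegral_const_mul _ (h2.mul_const _), lintegral_mul_const _ h2, h1, one_mul]

/-- The mean exit time is dominated by nonnegative solutions of the Poisson equation. -/
theorem meanExitTime_le (hfin : ∀ x, {y | 0 < Γ.weight x y}.Finite)
    (hπ : ∀ x, 0 < Γ.cond x) (w : WalkType) {B : Finset V} {g : B → ℝ} (hg0 : ∀ z, 0 ≤ g z)
    (hg : ∀ z, (Γ.killedGenerator w B *ᵥ g) z = -1) (x : B) :
    Γ.meanExitTime w x B ≤ ENNReal.ofReal (g x) := by
  classical
  set G : V → ℝ≥0∞ := fun z => if h : z ∈ B then ENNReal.ofReal (g ⟨z, h⟩) else 0 with hG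
  have hGc : ∀ z : B, G z = ENNReal.ofReal (g z) := fun z => by simp [hG]
  have hharm : ∀ z ∈ B, Γ.meanHolding w z + ∑ y ∈ B, Γ.jumpPMF z y * G y = G z := by
    intro z hz
    have h1 := hg ⟨z, hz⟩
    rw [killedGenerator_mulVec] at h1
    have h2 := (theta_pos hπ w z).ne'
    have h3 := (hπ z).ne'
    have h4 : (Γ.rate w z)⁻¹ + ∑ y : B, Γ.weight z y / Γ.cond z * g y = g ⟨z, hz⟩ := by
      rw [div_eq_iff h2] at h1
      have h5 : ∑ y : B, Γ.weight z y / Γ.cond z * g y =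
          (∑ y : B, Γ.weight z y * g y) / Γ.cond z := by
        rw [Finset.sum_div]
        exact Finset.sum_congr rfl fun y _ => by ring
      rw [h5, rate]
      simp only at h1
      field_simp
      linarith
    have hnn : ∀ y : B, 0 ≤ Γ.weight z y / Γ.cond z * g y := fun y =>
      mul_nonneg (div_nonneg (Γ.weight_nonneg _ _) (hπ z).le) (hg0 y)
    rw [hGc ⟨z, hz⟩, ← h4, ENNReal.ofReal_add (inv_nonneg.2 (rate_pos hπ w z).le)
      (Finset.sum_nonneg fun y _ => hnn y), ← meanHolding_eq hπ,
      ENNReal.ofReal_sum_of_nonneg fun y _ => hnn y, ← Finset.sum_coe_sort B]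
    congr 1
    refine Finset.sum_congr rfl fun y _ => ?_
    rw [hGc y, jumpPMF_apply hfin hπ,
      ENNReal.ofReal_mul (div_nonneg (Γ.weight_nonneg _ _) (hπ z).le)]
  have hst := fun n => measurable_stay_indicator (V := V) B n
  have hcomp : ∀ (φ : V → ℝ≥0∞) (n : ℕ), Measurable fun Y : ℕ → V => φ (Y n) := fun φ n =>
    (Measurable.of_discrete (f := φ)).comp (measurable_pi_apply n)
  have hstep : ∀ n, ∫⁻ Y, (stay B (n + 1)).indicator 1 Y * G (Y (n + 1)) ∂Γ.jumpLaw x =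
      ∫⁻ Y, (stay B n).indicator 1 Y * ∑ y ∈ B, Γ.jumpPMF (Y n) y * G y ∂Γ.jumpLaw x := by
    intro n
    have e1 : ∀ Y : ℕ → V, (stay B (n + 1)).indicator 1 Y * G (Y (n + 1)) =
        ∑ y ∈ B, G y * ((stay B n).indicator 1 Y * {Y : ℕ → V | Y (n + 1) = y}.indicator 1 Y) := by
      intro Y
      by_cases hB : Y (n + 1) ∈ B
      · rw [Finset.sum_eq_single (Y (n + 1))]
        · have : Y ∈ stay B (n + 1) ↔ Y ∈ stay B n := by
            rw [stay_succ]
            exact and_iff_left hB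
          by_cases h : Y ∈ stay B n
          · simp [h, this.2 h]
          · simp [h, mt this.1 h]
        · intro z _ hz
          simp [Set.indicator, Ne.symm hz]
        · exact fun h => absurd hB h
      · have h0 : G (Y (n + 1)) = 0 := by simp [hG, hB]
        rw [h0, mul_zero]
        refine (Finset.sum_eq_zero fun y hy => ?_).symm
        have : Y (n + 1) ≠ y := fun h => hB (h ▸ hy)
        simp [Set.indicator, this]
    have e2 : ∀ Y : ℕ → V, (stay B n).indicator 1 Y * ∑ y ∈ B, Γ.jumpPMF (Y n) y * G y =
        ∑ y ∈ B, G y * ((stay B n).indicator 1 Y * Γ.jumpPMF (Y n) y) := by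
      intro Y
      rw [Finset.mul_sum]
      exact Finset.sum_congr rfl fun y _ => by ring
    rw [lintegral_congr e1, lintegral_congr e2, lintegral_finsetSum, lintegral_finsetSum]
    · refine Finset.sum_congr rfl fun y _ => ?_
      rw [lintegral_const_mul, lintegral_const_mul,
        lintegral_jumpLaw_succ (Γ := Γ) x n (hst n) (fun Y Z h => ?_) y]
      · have := stay_congr B n h
        by_cases h3 : Y ∈ stay B n
        · simp [h3, this.1 h3]
        · simp [h3, mt this.2 h3]
      · exact (hst n).mul (hcomp (fun z => Γ.jumpPMF z y) n)
      · exact (hst n).mul (measurable_apply_indicator (n + 1) y)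
    · exact fun y _ => ((hst n).mul (hcomp (fun z => Γ.jumpPMF z y) n)).const_mul _
    · exact fun y _ => ((hst n).mul (measurable_apply_indicator (n + 1) y)).const_mul _
  have hbal : ∀ n, ∫⁻ Y, (stay B n).indicator 1 Y * Γ.meanHolding w (Y n) ∂Γ.jumpLaw x +
      ∫⁻ Y, (stay B (n + 1)).indicator 1 Y * G (Y (n + 1)) ∂Γ.jumpLaw x =
      ∫⁻ Y, (stay B n).indicator 1 Y * G (Y n) ∂Γ.jumpLaw x := by
    intro n
    have hm : Measurable fun Y : ℕ → V => (stay B n).indicator 1 Y * Γ.meanHolding w (Y n) :=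
      (hst n).mul (hcomp _ n)
    rw [hstep n, ← lintegral_add_left hm]
    refine lintegral_congr fun Y => ?_
    by_cases h : Y ∈ stay B n
    · rw [← mul_add, hharm _ (h n le_rfl)]
    · simp [h]
  have hsum : ∀ N, ∑ n ∈ Finset.range N,
      ∫⁻ Y, (stay B n).indicator 1 Y * Γ.meanHolding w (Y n) ∂Γ.jumpLaw x +
      ∫⁻ Y, (stay B N).indicator 1 Y * G (Y N) ∂Γ.jumpLaw x = ENNReal.ofReal (g x) := by
    intro N
    induction N with
    | zero =>
      have hm : Measurable fun Y : ℕ → V => (stay B 0).indicator 1 Y * G (Y 0) :=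
        (hst 0).mul (hcomp G 0)
      rw [Finset.sum_range_zero, zero_add, lintegral_jumpLaw_zero (Γ := Γ) (x : V) hm]
      · have h1 : (fun _ : ℕ => (x : V)) ∈ stay B 0 := fun i _ => x.2
        rw [Set.indicator_of_mem h1, Pi.one_apply, one_mul, hGc]
      · intro Y Z h
        have h1 := stay_congr B 0 (Y := Y) (Z := Z) fun i hi => by rwa [Nat.le_zero.1 hi]
        rw [h]
        by_cases h3 : Y ∈ stay B 0
        · simp [h3, h1.1 h3]
        · simp [h3, mt h1.2 h3]
    | succ N ih => rw [Finset.sum_range_succ, add_assoc, hbal N, ih]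
  refine (meanExitTime_le_tsum hπ w B x).trans ?_
  exact ENNReal.tsum_le_of_sum_range_le fun N => le_self_add.trans_eq (hsum N)

end WeightedGraph

end

noncomputable section

namespace WeightedGraph

open Filter

variable {V : Type*} {Γ : WeightedGraph V}

theorem exitTime_mono (w : WalkType) {A A' : Set V} (h : A ⊆ A') (ω : (ℕ → V) × (ℕ → ℝ)) :
    Γ.exitTime w A ω ≤ Γ.exitTime w A' ω :=
  iInf_mono fun _ => le_iInf fun hA' => iInf_le_of_le (fun y hy => hA' y (h hy)) le_rfl

theorem chemDist_self_le (x : V) : Γ.chemDist x x ≤ 0 := by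
  refine (ciInf_le ⟨0, ?_⟩ SimpleGraph.Walk.nil).trans (by simp)
  rintro _ ⟨p, rfl⟩
  refine List.sum_nonneg fun a ha => ?_
  obtain ⟨e, -, rfl⟩ := List.mem_map.1 ha
  exact le_min zero_le_one (Real.rpow_nonneg (Γ.weight_nonneg _ _) _)

variable [Countable V] [MeasurableSpace V] [DiscreteMeasurableSpace V]

theorem meanExitTime_mono (w : WalkType) (x : V) {A A' : Set V} (h : A ⊆ A') :
    Γ.meanExitTime w x A ≤ Γ.meanExitTime w x A' :=
  lintegral_mono fun ω => exitTime_mono w h ω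

/-- The consequences of the standing assumption for balls around `x₀` of large radius. -/
structure ScaleEstimates (Γ : WeightedGraph V) (w : WalkType) (d A c₃ c₄ e₀ C : ℝ) (x₀ : V) :
    Prop where
  connected : Γ.IsConnected
  finite_neighbors : ∀ x, {y | 0 < Γ.weight x y}.Finite
  cond_pos : ∀ x, 0 < Γ.cond x
  heat : ∀ a : ℝ, 0 < a → ∀ᶠ r : ℝ in atTop, ∀ t, a * r ^ 2 ≤ t →
    ∀ x ∈ Γ.ball x₀ r, ∀ y ∈ Γ.ball x₀ r, Γ.heatKernel w t x y ≤ A * t ^ (-d / 2)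
  exit : ∀ᶠ r : ℝ in atTop, ENNReal.ofReal (e₀ * r ^ 2) ≤ Γ.meanExitTime w x₀ (Γ.ball x₀ r)
  harnack : ∀ᶠ R : ℝ in atTop, ∀ h : V → ℝ, (∀ x ∈ Γ.closure (Γ.ball x₀ R), 0 ≤ h x) →
    (∀ x ∈ Γ.ball x₀ R, Γ.laplacian w h x = 0) →
    ∀ x ∈ Γ.ball x₀ (R / 2), ∀ y ∈ Γ.ball x₀ (R / 2), h x ≤ C * h y
  volume_lower : ∀ᶠ r : ℝ in atTop, c₃ * r ^ d ≤ Γ.mass w (Γ.ball x₀ r)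
  volume_upper : ∀ᶠ r : ℝ in atTop, Γ.mass w (Γ.ball x₀ r) ≤ c₄ * r ^ d

/-- The constant of the lower bound of mean exit times from balls of the graph distance. -/
def exitConst (w : WalkType) (K : WalkConstants) : ℝ :=
  match w with
  | .csrw => K.c₂
  | .vsrw => K.c₂ * K.c₅ ^ 2

theorem exitConst_pos (w : WalkType) (K : WalkConstants) : 0 < exitConst w K := by
  have h1 := K.c₂_pos
  have h2 := K.c₅_pos
  cases w <;> simp only [exitConst] <;> positivity

variable {w : WalkType} {d : ℝ} {K : WalkConstants} {x₀ : V}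

theorem StandingAssumption.nontrivial (hd : 0 < d) (h : Γ.StandingAssumption w d K x₀) :
    Nontrivial V := by
  by_contra hV
  rw [not_nontrivial_iff_subsingleton] at hV
  obtain ⟨R₂, -, hvol⟩ := h.volume
  have h1 : Tendsto (fun R : ℝ => K.c₃ * R ^ d) atTop atTop :=
    (tendsto_rpow_atTop hd).const_mul_atTop K.c₃_pos
  obtain ⟨R, hR2, hR, hR0⟩ := ((eventually_ge_atTop R₂).and
    ((h1.eventually_gt_atTop (Γ.theta w x₀)).and (eventually_gt_atTop 0))).exists
  have h2 : Γ.ball x₀ R = {x₀} :=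
    Set.eq_singleton_iff_unique_mem.2 ⟨mem_ball_self x₀ hR0, fun _ _ => Subsingleton.elim _ _⟩
  have h3 := (hvol R hR2).1
  rw [h2, mass, finsum_mem_singleton] at h3
  linarith

theorem StandingAssumption.eventually_exit (h : Γ.StandingAssumption w d K x₀) :
    ∀ᶠ r : ℝ in atTop, ENNReal.ofReal (exitConst w K * r ^ 2) ≤
      Γ.meanExitTime w x₀ (Γ.ball x₀ r) := by
  cases w with
  | csrw =>
    obtain ⟨R₀, hR₀, hexit⟩ := h.exit_csrw rfl
    filter_upwards [eventually_ge_atTop R₀] with r hr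
    exact hexit r hr x₀ (mem_ball_self x₀ (Real.rpow_pos_of_pos (by linarith) _))
  | vsrw =>
    obtain ⟨R₀, hR₀, hexit⟩ := h.exit_vsrw rfl
    obtain ⟨R₄, hR₄, hdist⟩ := h.dist_vsrw rfl
    have hc := K.c₅_pos
    filter_upwards [eventually_ge_atTop R₄, eventually_ge_atTop (R₀ / K.c₅)] with r hr4 hr0
    have hr : R₀ ≤ K.c₅ * r := by
      rw [div_le_iff₀ hc] at hr0
      linarith
    have h1 := hexit (K.c₅ * r) hr x₀
      ((chemDist_self_le x₀).trans_lt (Real.rpow_pos_of_pos (by linarith) _))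
    have h2 : Γ.chemBall x₀ (K.c₅ * r) ⊆ Γ.ball x₀ r := by
      intro y hy
      by_contra hyr
      have hyr' : r ≤ (Γ.toGraph.dist x₀ y : ℝ) := not_lt.1 hyr
      have h3 := hdist r hr4 x₀ (mem_ball_self x₀ (by linarith)) y hyr'
      have h4 : Γ.chemDist x₀ y < K.c₅ * r := hy
      have h5 := mul_le_mul_of_nonneg_left hyr' hc.le
      linarith
    refine le_trans (le_of_eq ?_) (h1.trans (meanExitTime_mono _ _ h2))
    simp only [exitConst]
    congr 1
    ring

theorem StandingAssumption.eventually_heat (h : Γ.StandingAssumption w d K x₀) {a : ℝ}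
    (ha : 0 < a) : ∀ᶠ r : ℝ in atTop, ∀ t, a * r ^ 2 ≤ t →
      ∀ x ∈ Γ.ball x₀ r, ∀ y ∈ Γ.ball x₀ r, Γ.heatKernel w t x y ≤ K.c₁ * t ^ (-d / 2) := by
  obtain ⟨T₀, hT₀, hheat⟩ := h.heat_upper
  have hδ := K.δ_pos
  have h1 : Tendsto (fun r : ℝ => a * r ^ 2) atTop atTop :=
    (tendsto_pow_atTop two_ne_zero).const_mul_atTop ha
  have h2 : Tendsto (fun r : ℝ => a ^ ((1 + K.δ) / 2) * r ^ K.δ) atTop atTop :=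
    (tendsto_rpow_atTop hδ).const_mul_atTop (Real.rpow_pos_of_pos ha _)
  filter_upwards [h1.eventually_ge_atTop T₀, h2.eventually_ge_atTop 1, eventually_gt_atTop 0]
    with r hr1 hr2 hr0 t ht
  have h3 : r ≤ t ^ ((1 + K.δ) / 2) := by
    calc r = 1 * r := (one_mul r).symm
      _ ≤ a ^ ((1 + K.δ) / 2) * r ^ K.δ * r := mul_le_mul_of_nonneg_right hr2 hr0.le
      _ = (a * r ^ 2) ^ ((1 + K.δ) / 2) := by
        rw [Real.mul_rpow ha.le (by positivity), ← Real.rpow_natCast, ← Real.rpow_mul hr0.le,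
          mul_assoc, ← Real.rpow_add_one hr0.ne']
        congr 2
        push_cast
        ring
      _ ≤ t ^ ((1 + K.δ) / 2) := Real.rpow_le_rpow (by positivity) ht (by linarith)
  exact fun x hx y hy => hheat t (hr1.trans ht) x (ball_mono x₀ h3 hx) y (ball_mono x₀ h3 hy)

theorem StandingAssumption.scaleEstimates (hd : 0 < d) {M : ℕ} (hconn : Γ.IsConnected)
    (hdeg : Γ.DegreeLE M) (h : Γ.StandingAssumption w d K x₀) :
    Γ.ScaleEstimates w d K.c₁ K.c₃ K.c₄ (exitConst w K) (max 1 K.C_E) x₀ := by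
  have := h.nontrivial hd
  obtain ⟨R₁, hR₁, hEHI⟩ := h.harnack
  obtain ⟨R₂, hR₂, hvol⟩ := h.volume
  refine ⟨hconn, hdeg.finite_neighbors, WeightedGraph.cond_pos hconn hdeg.finite_neighbors,
    fun a ha => h.eventually_heat ha, h.eventually_exit, ?_, ?_, ?_⟩
  · filter_upwards [eventually_ge_atTop R₁] with R hR f hf0 hf x hx y hy
    refine (hEHI R hR f hf0 hf x hx y hy).trans
      (mul_le_mul_of_nonneg_right (le_max_right _ _) (hf0 y (Or.inl ?_)))
    exact ball_mono x₀ (by linarith) hy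
  · filter_upwards [eventually_ge_atTop R₂] with r hr
    exact (hvol r hr).1
  · filter_upwards [eventually_ge_atTop R₂] with r hr
    exact (hvol r hr).2 x₀ (mem_ball_self x₀ (Real.rpow_pos_of_pos (by linarith) _))

namespace ScaleEstimates

variable {A c₃ c₄ e₀ C C₀ : ℝ} (H : Γ.ScaleEstimates w d A c₃ c₄ e₀ C x₀)
include H

/-- The ball around `x₀` as a finite set. -/
def finsetBall (r : ℝ) : Finset V := (finite_ball H.connected H.finite_neighbors x₀ r).toFinset

theorem coe_finsetBall (r : ℝ) : (H.finsetBall r : Set V) = Γ.ball x₀ r := by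
  simp [finsetBall]

theorem mem_finsetBall {r : ℝ} {x : V} : x ∈ H.finsetBall r ↔ x ∈ Γ.ball x₀ r := by
  simp [finsetBall]

theorem isSubMarkov (B : Finset V) :
    IsSubMarkov (Γ.killedGenerator w B) (fun x => Γ.theta w x) :=
  isSubMarkov_killedGenerator H.finite_neighbors H.cond_pos w B

theorem sum_theta_le {r : ℝ} (hr : Γ.mass w (Γ.ball x₀ r) ≤ c₄ * r ^ d) :
    ∑ x : H.finsetBall r, Γ.theta w x ≤ c₄ * r ^ d := by
  rw [Finset.sum_coe_sort (H.finsetBall r) (fun x => Γ.theta w x), ← mass_eq_sum,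
    H.coe_finsetBall]
  exact hr

theorem eventually_killedKernel_le {a : ℝ} (ha : 0 < a) : ∀ᶠ r : ℝ in atTop,
    ∀ t, a * r ^ 2 ≤ t → ∀ x ∈ Γ.ball x₀ r, ∀ y ∈ Γ.ball x₀ r,
      Γ.killedKernel w (H.finsetBall r) t x y ≤ A * t ^ (-d / 2) := by
  filter_upwards [H.heat a ha] with r hr t ht x hx y hy
  refine le_trans ?_ (hr t ht x hx y hy)
  exact killedKernel_le_heatKernel H.finite_neighbors H.cond_pos w (H.mem_finsetBall.2 hx)
    (H.mem_finsetBall.2 hy) (le_trans (by positivity) ht)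

theorem eventually_survival_le (hA : 0 < A) (hC₀ : 1 ≤ C₀)
    (hhalf : A * c₄ * C₀ ^ (-d / 2) ≤ 1 / 2) : ∀ᶠ r : ℝ in atTop,
      ∀ x, Γ.survival w (H.finsetBall r) (C₀ * r ^ 2) x ≤ 1 / 2 := by
  classical
  filter_upwards [H.eventually_killedKernel_le one_pos, H.volume_upper, eventually_gt_atTop 0]
    with r hr hvol hr0 x
  have h1 : ∀ y, semigroup (Γ.killedGenerator w (H.finsetBall r)) (C₀ * r ^ 2) x y ≤
      A * (C₀ * r ^ 2) ^ (-d / 2) * Γ.theta w y := fun y => by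
    have h := hr (C₀ * r ^ 2) (by gcongr) x (H.mem_finsetBall.1 x.2) y (H.mem_finsetBall.1 y.2)
    rw [killedKernel_coe, div_le_iff₀ (theta_pos H.cond_pos w y)] at h
    exact h
  have hC₀' : 0 < C₀ := by linarith
  calc Γ.survival w (H.finsetBall r) (C₀ * r ^ 2) x
      = ∑ y, semigroup (Γ.killedGenerator w (H.finsetBall r)) (C₀ * r ^ 2) x y := by
        simp [survival, Matrix.mulVec, dotProduct]
    _ ≤ ∑ y : H.finsetBall r, A * (C₀ * r ^ 2) ^ (-d / 2) * Γ.theta w y :=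
        Finset.sum_le_sum fun y _ => h1 y
    _ ≤ A * (C₀ * r ^ 2) ^ (-d / 2) * (c₄ * r ^ d) := by
        rw [← Finset.mul_sum]
        exact mul_le_mul_of_nonneg_left (H.sum_theta_le hvol) (by positivity)
    _ = A * c₄ * C₀ ^ (-d / 2) := by
        have h2 : (C₀ * r ^ 2) ^ (-d / 2) = C₀ ^ (-d / 2) * r ^ (-d) := by
          rw [Real.mul_rpow hC₀'.le (by positivity), ← Real.rpow_natCast, ← Real.rpow_mul hr0.le]
          congr 2
          push_cast
          ring
        have h3 : r ^ (-d) * r ^ d = 1 := by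
          rw [← Real.rpow_add hr0]; simp
        rw [h2]
        linear_combination (A * c₄ * C₀ ^ (-d / 2)) * h3
    _ ≤ 1 / 2 := hhalf

theorem eventually_le_survival (hA : 0 < A) (hC₀ : 1 ≤ C₀)
    (hhalf : A * c₄ * C₀ ^ (-d / 2) ≤ 1 / 2) : ∀ᶠ r : ℝ in atTop,
      ∀ s, 0 ≤ s → s ≤ e₀ * r ^ 2 / 2 → ∀ x : H.finsetBall r, (x : V) = x₀ →
        e₀ / (4 * C₀) ≤ Γ.survival w (H.finsetBall r) s x := by
  classical
  filter_upwards [H.eventually_survival_le hA hC₀ hhalf, H.exit, eventually_gt_atTop 0]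
    with r hr hexit hr0 s hs0 hs x hx
  have hK := H.isSubMarkov (H.finsetBall r)
  have ht : 0 ≤ C₀ * r ^ 2 := by positivity
  obtain ⟨g, hg⟩ := hK.exists_generator_eq ht hr (fun _ => -1)
  have hg' : ∀ z, (Matrix.mulVec (Γ.killedGenerator w (H.finsetBall r)) g) z = -1 := fun z => by
    rw [hg]
  have hg0 := hK.nonneg_of_generator_nonpos ht hr (g := g) fun z => by rw [hg' z]; norm_num
  have h1 := meanExitTime_le H.finite_neighbors H.cond_pos w hg0 hg' x
  rw [H.coe_finsetBall, hx] at h1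
  have h2 := (ENNReal.ofReal_le_ofReal_iff (hg0 x)).1 (hexit.trans h1)
  have h3 := hK.le_add_survival ht hs0 hr hg' x
  have h4 : e₀ * r ^ 2 / 2 ≤ 2 * (C₀ * r ^ 2) * Γ.survival w (H.finsetBall r) s x := by
    unfold survival
    linarith
  rw [div_le_iff₀ (by positivity)]
  have hr2 : 0 < r ^ 2 := by positivity
  refine le_of_mul_le_mul_right ?_ hr2
  nlinarith

theorem eventually_le_diagonal (hA : 0 < A) (hc₄ : 0 < c₄) (he₀ : 0 < e₀) (hC₀ : 1 ≤ C₀)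
    (hhalf : A * c₄ * C₀ ^ (-d / 2) ≤ 1 / 2) : ∀ᶠ r : ℝ in atTop,
      ∀ t, 0 ≤ t → t ≤ e₀ * r ^ 2 →
        (e₀ / (4 * C₀)) ^ 2 / c₄ * r ^ (-d) ≤ Γ.killedKernel w (H.finsetBall r) t x₀ x₀ := by
  classical
  filter_upwards [H.eventually_le_survival hA hC₀ hhalf, H.volume_upper, eventually_gt_atTop 0]
    with r hr hvol hr0 t ht0 ht
  have hx : x₀ ∈ H.finsetBall r := H.mem_finsetBall.2 (mem_ball_self x₀ hr0)
  have h1 := hr (t / 2) (by linarith) (by linarith) ⟨x₀, hx⟩ rfl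
  have h2 := (H.isSubMarkov (H.finsetBall r)).sq_survival_le (t := t / 2) ⟨x₀, hx⟩
  rw [add_halves] at h2
  have h3 := killedKernel_coe (Γ := Γ) w (H.finsetBall r) t ⟨x₀, hx⟩ ⟨x₀, hx⟩
  simp only at h3 h2
  rw [← h3] at h2
  have h4 := H.sum_theta_le hvol
  have h5 : 0 < e₀ / (4 * C₀) := by positivity
  have h6 : (e₀ / (4 * C₀)) ^ 2 ≤ c₄ * r ^ d * Γ.killedKernel w (H.finsetBall r) t x₀ x₀ := by
    refine (pow_le_pow_left₀ h5.le h1 2).trans (h2.trans ?_)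
    exact mul_le_mul_of_nonneg_right h4
      (killedKernel_nonneg H.finite_neighbors H.cond_pos w _ ht0 _ _)
  have hrd : 0 < r ^ d := Real.rpow_pos_of_pos hr0 _
  rw [Real.rpow_neg hr0.le, ← div_eq_mul_inv, div_div, div_le_iff₀ (by positivity)]
  linarith

end ScaleEstimates

end WeightedGraph

end

noncomputable section

namespace WeightedGraph

open Filter

variable {V : Type*} {Γ : WeightedGraph V}

/-- The oscillation of `u` on the ball `B(x₀, r)` is at most `D`. -/
def OscLE (Γ : WeightedGraph V) (x₀ : V) (u : V → ℝ) (r D : ℝ) : Prop :=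
  ∀ x ∈ Γ.ball x₀ r, ∀ y ∈ Γ.ball x₀ r, u x - u y ≤ D

variable [Countable V] [MeasurableSpace V] [DiscreteMeasurableSpace V]
  {w : WalkType} {d : ℝ} {x₀ : V}

namespace ScaleEstimates

variable {A c₃ c₄ e₀ C C₀ : ℝ} (H : Γ.ScaleEstimates w d A c₃ c₄ e₀ C x₀)
include H

theorem eventually_oscillation (hA : 0 < A) (hC : 0 < C) (hC₀ : 1 ≤ C₀)
    (hhalf : A * c₄ * C₀ ^ (-d / 2) ≤ 1 / 2) : ∀ᶠ ρ : ℝ in atTop,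
      ∀ (u : V → ℝ) (F D : ℝ), (∀ x ∈ Γ.ball x₀ ρ, |Γ.laplacian w u x| ≤ F) →
        Γ.OscLE x₀ u (2 * ρ) D →
        Γ.OscLE x₀ u (ρ / 2) (C / (C + 1) * D + 8 * (C₀ * ρ ^ 2) * F) := by
  filter_upwards [H.eventually_survival_le hA hC₀ hhalf, H.harnack, eventually_ge_atTop 1]
    with ρ hsurv hEHI hρ u F D hF hosc x hx y hy
  obtain ⟨z, hz, hmin⟩ := Finset.exists_min_image (H.finsetBall (2 * ρ)) u
    ⟨x₀, H.mem_finsetBall.2 (mem_ball_self x₀ (by linarith))⟩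
  rw [H.mem_finsetBall] at hz
  refine elliptic_oscillation H.connected H.finite_neighbors H.cond_pos w hC (H.finsetBall ρ)
    (H.coe_finsetBall ρ) hEHI (by linarith) (by positivity) hsurv hF (m := u z) (fun v hv => ?_)
    x y hx hy
  have hv' : v ∈ Γ.ball x₀ (2 * ρ) := ball_mono x₀ (by linarith) hv
  exact ⟨hmin v (H.mem_finsetBall.2 hv'), by linarith [hosc v hv' z hz]⟩

/-- Iterated oscillation decay of functions with small Laplacian. -/
theorem eventually_oscillation_iterate (hA : 0 < A) (hC : 1 ≤ C) (hC₀ : 1 ≤ C₀)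
    (hhalf : A * c₄ * C₀ ^ (-d / 2) ≤ 1 / 2) {U Φ : ℝ} (hΦ : 0 ≤ Φ) (k : ℕ) :
    ∀ᶠ r : ℝ in atTop, ∀ (u : V → ℝ) (s : ℝ), 0 ≤ s →
      (∀ x ∈ Γ.ball x₀ r, |Γ.laplacian w u x| ≤ Φ * s / r ^ 2) → Γ.OscLE x₀ u r (U * s) →
      Γ.OscLE x₀ u (r / 4 ^ k) ((U + 8 * C₀ * Φ) * (C / (C + 1)) ^ k * s) := by
  obtain ⟨ρ₁, hρ₁⟩ := eventually_atTop.1 (H.eventually_oscillation hA (by linarith) hC₀ hhalf)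
  filter_upwards [eventually_ge_atTop (2 * 4 ^ k * ρ₁), eventually_gt_atTop 0]
    with r hr hr0 u s hs hF hosc
  set γ := C / (C + 1) with hγ
  have hγ0 : 1 / 2 ≤ γ := by
    rw [hγ, div_le_div_iff₀ two_pos (by linarith)]
    linarith
  have key : ∀ j ≤ k, Γ.OscLE x₀ u (r / 4 ^ j)
      (((U + 8 * C₀ * Φ) * γ ^ j - 8 * C₀ * Φ * (1 / 16) ^ j) * s) := by
    intro j
    induction j with
    | zero =>
      intro _
      convert hosc using 1
      · simp
      · ring
    | succ j ih =>
      intro hj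
      have h1 := ih (by omega)
      have hpow : (4 : ℝ) ^ j ≤ 4 ^ k := pow_le_pow_right₀ (by norm_num) (by omega)
      have h4j : (0 : ℝ) < 4 ^ j := by positivity
      set ρ := r / 4 ^ j / 2 with hρ
      have hρ' : ρ₁ ≤ ρ := by
        rw [hρ, div_div, le_div_iff₀ (by positivity)]
        rcases le_total 0 ρ₁ with h | h
        · nlinarith
        · nlinarith
      have hρr : ρ ≤ r := by
        rw [hρ, div_div, div_le_iff₀ (by positivity)]
        have : (1 : ℝ) ≤ 4 ^ j := one_le_pow₀ (by norm_num)
        nlinarith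
      have h2 := hρ₁ ρ hρ' u (Φ * s / r ^ 2) _ (fun x hx => hF x (ball_mono x₀ hρr hx))
        (by rwa [show 2 * ρ = r / 4 ^ j by rw [hρ]; ring])
      have h3 : ρ / 2 = r / 4 ^ (j + 1) := by
        rw [hρ, pow_succ]
        field_simp
        norm_num
      rw [h3] at h2
      intro x hx y hy
      refine (h2 x hx y hy).trans ?_
      have h16 : ((1 : ℝ) / 16) ^ j = 1 / (4 ^ j) ^ 2 := by
        rw [← pow_mul, mul_comm j 2, pow_mul, div_pow, one_pow]
        norm_num
      have h5 : 8 * (C₀ * ρ ^ 2) * (Φ * s / r ^ 2) = 2 * C₀ * Φ * (1 / 16) ^ j * s := by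
        rw [h16, hρ]
        field_simp
        ring
      rw [h5, pow_succ, pow_succ]
      have h6 : 0 ≤ C₀ * Φ * (1 / 16) ^ j * s := by positivity
      nlinarith [mul_le_mul_of_nonneg_right hγ0 h6]
  intro x hx y hy
  refine (key k le_rfl x hx y hy).trans ?_
  have : 0 ≤ 8 * C₀ * Φ * (1 / 16) ^ k := by positivity
  exact mul_le_mul_of_nonneg_right (by linarith) hs

theorem laplacian_killedKernel (B : Finset V) (t : ℝ) (x y : B) :
    Γ.laplacian w (fun z => Γ.killedKernel w B t z y) x = open Classical in
      (Matrix.mulVec (Γ.killedGenerator w B)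
        (fun z => semigroup (Γ.killedGenerator w B) t z y / Γ.theta w y)) x := by
  rw [laplacian_eq_killed H.finite_neighbors w (B := B)]
  · congr 1
    ext z
    exact killedKernel_coe w B t z y
  · intro z hz
    rw [killedKernel, dif_neg (fun h => hz h.1)]

end ScaleEstimates

/-- The near diagonal lower bound of the heat kernel of the walk killed outside a ball. -/
theorem exists_near_diagonal {A c₄ e₀ C C₀ a : ℝ} (hd : 0 ≤ d) (hA : 0 < A) (hc₄ : 0 < c₄)
    (he₀ : 0 < e₀) (hC : 1 ≤ C) (hC₀ : 1 ≤ C₀) (hhalf : A * c₄ * C₀ ^ (-d / 2) ≤ 1 / 2)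
    (ha : 0 < a) (hae : a ≤ e₀) :
    ∃ k : ℕ, ∃ L : ℝ, 0 < L ∧ ∀ {V : Type*} [Countable V] [MeasurableSpace V]
      [DiscreteMeasurableSpace V] {Γ : WeightedGraph V} {w : WalkType} {x₀ : V} {c₃ : ℝ}
      (H : Γ.ScaleEstimates w d A c₃ c₄ e₀ C x₀), ∀ᶠ r : ℝ in atTop,
        ∀ t, a / 2 * r ^ 2 ≤ t → t ≤ a * r ^ 2 →
        ∀ x ∈ Γ.ball x₀ (r / 4 ^ k), ∀ y ∈ Γ.ball x₀ (r / 4 ^ k),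
          L * r ^ (-d) ≤ Γ.killedKernel w (H.finsetBall r) t x y := by
  set L₀ := (e₀ / (4 * C₀)) ^ 2 / c₄ with hL₀
  have hC₀' : 0 < C₀ := by linarith
  have hL₀pos : 0 < L₀ := by positivity
  set U := A * (a / 4) ^ (-d / 2) with hU
  have hUpos : 0 < U := by positivity
  set Φ := 8 * U / a with hΦ
  have hΦpos : 0 < Φ := by positivity
  have hγ0 : 0 ≤ C / (C + 1) := by positivity
  have hγ1 : C / (C + 1) < 1 := by
    rw [div_lt_one (by linarith)]; linarith
  obtain ⟨k, hk⟩ := exists_pow_lt_of_lt_one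
    (show 0 < L₀ / 4 / (U + 8 * C₀ * Φ) by positivity) hγ1
  rw [lt_div_iff₀ (by positivity)] at hk
  refine ⟨k, L₀ / 2, by positivity, fun {V} _ _ _ {Γ w x₀ c₃} H => ?_⟩
  classical
  filter_upwards [H.eventually_killedKernel_le (show 0 < a / 4 by positivity),
    H.eventually_le_diagonal hA hc₄ he₀ hC₀ hhalf,
    H.eventually_oscillation_iterate hA hC hC₀ hhalf (U := U) hΦpos.le k, eventually_gt_atTop 0]
    with r hup hdiag hosc hr0 t ht1 ht2 x hx y hy
  set B := H.finsetBall r with hB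
  have hr2 : 0 < r ^ 2 := by positivity
  have ht0 : 0 < t := lt_of_lt_of_le (by positivity) ht1
  have hrd : 0 < r ^ (-d) := Real.rpow_pos_of_pos hr0 _
  have hK := H.isSubMarkov B
  have hup' : ∀ s, a / 4 * r ^ 2 ≤ s → ∀ x ∈ Γ.ball x₀ r, ∀ y ∈ Γ.ball x₀ r,
      Γ.killedKernel w B s x y ≤ U * r ^ (-d) := by
    intro s hs x hx y hy
    have hs0 : 0 < s := lt_of_lt_of_le (by positivity) hs
    refine (hup s hs x hx y hy).trans ?_
    have h1 : s ^ (-d / 2) ≤ (a / 4 * r ^ 2) ^ (-d / 2) :=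
      Real.rpow_le_rpow_of_nonpos (by positivity) hs (by linarith)
    have h2 : (a / 4 * r ^ 2) ^ (-d / 2) = (a / 4) ^ (-d / 2) * r ^ (-d) := by
      rw [Real.mul_rpow (by positivity) (by positivity), ← Real.rpow_natCast,
        ← Real.rpow_mul hr0.le]
      congr 2
      push_cast
      ring
    rw [hU, mul_assoc, ← h2]
    exact mul_le_mul_of_nonneg_left h1 hA.le
  have hosc' : ∀ y ∈ Γ.ball x₀ r, Γ.OscLE x₀ (fun z => Γ.killedKernel w B t z y) (r / 4 ^ k)
      (L₀ / 4 * r ^ (-d)) := by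
    intro y hy
    have h1 : ∀ s, a / 4 * r ^ 2 ≤ s → ∀ z : B,
        semigroup (Γ.killedGenerator w B) s z z / Γ.theta w z ≤ U * r ^ (-d) := by
      intro s hs z
      have h := hup' s hs z (H.mem_finsetBall.1 z.2) z (H.mem_finsetBall.1 z.2)
      rwa [killedKernel_coe] at h
    have h2 := hosc (fun z => Γ.killedKernel w B t z y) (r ^ (-d)) hrd.le (fun z hz => ?_)
      (fun v hv z hz => ?_)
    · intro v hv z hz
      refine (h2 v hv z hz).trans (mul_le_mul_of_nonneg_right ?_ hrd.le)
      linarith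
    · have h3 := H.laplacian_killedKernel B t ⟨z, H.mem_finsetBall.2 hz⟩
        ⟨y, H.mem_finsetBall.2 hy⟩
      simp only at h3
      rw [h3]
      refine (hK.abs_deriv_kernel_le ht0 (h1 t (by nlinarith)) (h1 (t / 2) (by linarith))
        _ _).trans ?_
      rw [div_le_div_iff₀ ht0 hr2, hΦ]
      have h4 : 8 * U / a * r ^ (-d) * t = 4 * (U * r ^ (-d)) * (2 * t / a) := by ring
      rw [h4]
      refine mul_le_mul_of_nonneg_left ?_ (by positivity)
      rw [le_div_iff₀ ha]
      linarith
    · have h5 := hup' t (by nlinarith) v hv y hy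
      have h6 := killedKernel_nonneg H.finite_neighbors H.cond_pos w B ht0.le z y
      linarith
  have hkr : r / 4 ^ k ≤ r := div_le_self hr0.le (one_le_pow₀ (by norm_num))
  have hx₀ : x₀ ∈ Γ.ball x₀ (r / 4 ^ k) := mem_ball_self x₀ (by positivity)
  have h1 := hdiag t ht0.le (ht2.trans (by gcongr))
  have h2 := hosc' x₀ (ball_mono x₀ hkr hx₀) x₀ hx₀ y hy
  have h3 := hosc' y (ball_mono x₀ hkr hy) x₀ hx₀ x hx
  have h4 := killedKernel_symm H.finite_neighbors H.cond_pos w B t x₀ y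
  simp only at h2 h3
  rw [← hL₀] at h1
  linarith

end WeightedGraph

end

noncomputable section

namespace WeightedGraph

open Filter

/-- The oscillation of `u` on the cylinder `[τ - 4 r ^ 2, τ] × B(x₀, r)` is at most `D`. -/
def CylinderOscLE {V : Type*} (Γ : WeightedGraph V) (x₀ : V) (u : ℝ → V → ℝ) (τ r D : ℝ) : Prop :=
  ∃ m, ∀ s ∈ Icc (τ - 4 * r ^ 2) τ, ∀ x ∈ Γ.ball x₀ r, m ≤ u s x ∧ u s x ≤ m + D

/-- Oscillation decay of caloric functions. -/
theorem exists_caloric_oscillation {d A c₃ c₄ e₀ C : ℝ} (hd : 0 < d) (hA : 0 < A) (hc₃ : 0 < c₃)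
    (hc₄ : 0 < c₄) (he₀ : 0 < e₀) (hC : 1 ≤ C) :
    ∃ μ η : ℝ, 0 < μ ∧ μ < 1 ∧ 0 < η ∧ η < 1 ∧ ∀ {V : Type*} [Countable V] [MeasurableSpace V]
      [DiscreteMeasurableSpace V] {Γ : WeightedGraph V} {w : WalkType} {x₀ : V},
      Γ.ScaleEstimates w d A c₃ c₄ e₀ C x₀ → ∀ᶠ r : ℝ in atTop,
        ∀ (τ D : ℝ) (u : ℝ → V → ℝ), 4 * r ^ 2 < τ →
          (∀ t ∈ Ioo 0 τ, ∀ y ∈ Γ.ball x₀ r,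
            HasDerivAt (fun s => u s y) (Γ.laplacian w (u t) y) t) →
          (∀ y ∈ Γ.ball x₀ r, ContinuousOn (fun s => u s y) (Ioc 0 τ)) →
          Γ.CylinderOscLE x₀ u τ r D → Γ.CylinderOscLE x₀ u τ (μ * r) ((1 - η) * D) := by
  set C₀ := max 1 ((2 * A * c₄) ^ (2 / d)) with hC₀def
  have hC₀ : 1 ≤ C₀ := le_max_left _ _
  have hC₀' : 0 < C₀ := by linarith
  have hhalf : A * c₄ * C₀ ^ (-d / 2) ≤ 1 / 2 := by
    have h1 : 2 * A * c₄ ≤ C₀ ^ (d / 2) := by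
      calc 2 * A * c₄ = ((2 * A * c₄) ^ (2 / d)) ^ (d / 2) := by
            rw [← Real.rpow_mul (by positivity), show 2 / d * (d / 2) = 1 by field_simp,
              Real.rpow_one]
        _ ≤ C₀ ^ (d / 2) :=
            Real.rpow_le_rpow (by positivity) (le_max_right _ _) (by positivity)
    rw [neg_div, Real.rpow_neg hC₀'.le, ← div_eq_mul_inv, div_le_div_iff₀ (by positivity) two_pos]
    linarith
  set a := min e₀ 4 with ha_def
  have ha : 0 < a := lt_min he₀ (by norm_num)
  have ha4 : a ≤ 4 := min_le_right _ _
  obtain ⟨k, L, hL, hNDL⟩ := exists_near_diagonal (d := d) hd.le hA hc₄ he₀ hC hC₀ hhalf ha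
    (min_le_left _ _)
  set l := min (1 / 4 ^ k) (a / 8) with hl_def
  have hl : 0 < l := by positivity
  have hlk : l ≤ 1 / 4 ^ k := min_le_left _ _
  have hla : l ≤ a / 8 := min_le_right _ _
  have hl2 : 4 * l ^ 2 ≤ a / 2 := by nlinarith
  set η := min (L * c₃ * l ^ d / 2) (1 / 2) with hη_def
  have hη : 0 < η := by positivity
  refine ⟨l / 2, η, by positivity, by linarith, hη,
    (min_le_right _ _).trans_lt (by norm_num), fun {V} _ _ _ {Γ w x₀} H => ?_⟩
  have hlt : Tendsto (fun r : ℝ => l * r) atTop atTop := tendsto_id.const_mul_atTop hl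
  have hev : ∀ᶠ r : ℝ in atTop,
        ∀ (τ D : ℝ) (u : ℝ → V → ℝ), 16 * r ^ 2 < τ →
          (∀ t ∈ Ioo 0 τ, ∀ y ∈ Γ.ball x₀ (2 * r),
            HasDerivAt (fun s => u s y) (Γ.laplacian w (u t) y) t) →
          (∀ y ∈ Γ.ball x₀ (2 * r), ContinuousOn (fun s => u s y) (Ioc 0 τ)) →
          Γ.CylinderOscLE x₀ u τ (2 * r) D → Γ.CylinderOscLE x₀ u τ (l * r) ((1 - η) * D) := by
    filter_upwards [hNDL H, hlt.eventually H.volume_lower, eventually_ge_atTop 1]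
      with r hndl hvol hr τ D u hτ hder hcont ⟨m, hm⟩
    have hr0 : 0 < r := by linarith
    have hr2 : 0 < r ^ 2 := by positivity
    set B := H.finsetBall r with hB
    set S := H.finsetBall (l * r) with hS
    set s₀ := τ - a * r ^ 2 with hs₀
    have hs₀0 : 0 < s₀ := by nlinarith
    have hlr : l * r ≤ r / 4 ^ k := by
      rw [div_eq_mul_one_div, mul_comm]
      exact mul_le_mul_of_nonneg_left hlk hr0.le
    have hkr : r / 4 ^ k ≤ r := div_le_self hr0.le (one_le_pow₀ (by norm_num))
    have hSB : S ⊆ B := fun y hy =>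
      H.mem_finsetBall.2 (ball_mono x₀ (hlr.trans hkr) (H.mem_finsetBall.1 hy))
    have hcl : Γ.closure (B : Set V) ⊆ Γ.ball x₀ (2 * r) := by
      rw [hB, H.coe_finsetBall]
      exact (closure_ball_subset H.connected x₀ r).trans (ball_mono x₀ (by linarith))
    have hB2 : ∀ y ∈ B, y ∈ Γ.ball x₀ (2 * r) := fun y hy => hcl (Or.inl hy)
    have hcyl : ∀ s, s₀ ≤ s → s ≤ τ → s ∈ Icc (τ - 4 * (2 * r) ^ 2) τ := fun s h1 h2 =>
      ⟨by nlinarith, h2⟩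
    have hD : 0 ≤ D := by
      have := hm τ ⟨by nlinarith, le_rfl⟩ x₀ (mem_ball_self x₀ (by linarith))
      linarith
    have hrd : 0 < r ^ (-d) := Real.rpow_pos_of_pos hr0 _
    have hlow : ∀ v : ℝ → V → ℝ,
        (∀ t ∈ Ioo 0 τ, ∀ y ∈ Γ.ball x₀ (2 * r),
          HasDerivAt (fun s => v s y) (Γ.laplacian w (v t) y) t) →
        (∀ y ∈ Γ.ball x₀ (2 * r), ContinuousOn (fun s => v s y) (Ioc 0 τ)) →
        (∀ s ∈ Icc (τ - 4 * (2 * r) ^ 2) τ, ∀ y ∈ Γ.ball x₀ (2 * r), 0 ≤ v s y) →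
        ∀ t ∈ Icc (τ - 4 * (l * r) ^ 2) τ, ∀ x ∈ Γ.ball x₀ (l * r),
          L * r ^ (-d) * ∑ y ∈ S, Γ.theta w y * v s₀ y ≤ v t x := by
      intro v hvd hvc hv0 t ht x hx
      have hts : a / 2 * r ^ 2 ≤ t - s₀ := by
        have := ht.1
        rw [mul_pow] at this
        nlinarith
      have hts' : t - s₀ ≤ a * r ^ 2 := by linarith [ht.2]
      have hst : s₀ ≤ t := by
        have : 0 ≤ a / 2 * r ^ 2 := by positivity
        linarith
      have hxS : x ∈ S := H.mem_finsetBall.2 hx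
      refine le_trans ?_ (sum_killedKernel_le H.finite_neighbors H.cond_pos w B (v := v) hst
        (fun y hy => (hvc y (hB2 y hy)).mono fun s hs => ⟨hs₀0.trans_le hs.1, hs.2.trans ht.2⟩)
        (fun s hs y hy => hvd s ⟨hs₀0.trans hs.1, hs.2.trans_le ht.2⟩ y (hB2 y hy))
        (fun s hs y hy => hv0 s (hcyl s hs.1.le (hs.2.le.trans ht.2)) y (hcl hy)) (hSB hxS))
      have hv0' : ∀ y ∈ B, 0 ≤ v s₀ y := fun y hy =>
        hv0 s₀ (hcyl s₀ le_rfl (hst.trans ht.2)) y (hB2 y hy)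
      refine le_trans ?_ (Finset.sum_le_sum_of_subset_of_nonneg hSB fun y hy _ =>
        mul_nonneg (mul_nonneg (killedKernel_nonneg H.finite_neighbors H.cond_pos w B
          (sub_nonneg.2 hst) _ _) (theta_nonneg w y)) (hv0' y hy))
      rw [Finset.mul_sum]
      refine Finset.sum_le_sum fun y hy => ?_
      rw [mul_assoc _ (Γ.theta w y)]
      refine mul_le_mul_of_nonneg_right ?_ (mul_nonneg (theta_nonneg w y) (hv0' y (hSB hy)))
      exact hndl (t - s₀) hts hts' x (ball_mono x₀ hlr hx) y
        (ball_mono x₀ hlr (H.mem_finsetBall.1 hy))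
    have hlow1 := hlow (fun s y => u s y - m)
      (fun t ht y hy => by
        rw [laplacian_sub_const w (u t)]
        exact (hder t ht y hy).sub_const m)
      (fun y hy => (hcont y hy).sub continuousOn_const)
      (fun s hs y hy => sub_nonneg.2 (hm s hs y hy).1)
    have hlow2 := hlow (fun s y => (m + D) - u s y)
      (fun t ht y hy => by
        rw [laplacian_const_sub w (u t)]
        exact (hder t ht y hy).const_sub (m + D))
      (fun y hy => continuousOn_const.sub (hcont y hy))
      (fun s hs y hy => sub_nonneg.2 (hm s hs y hy).2)
    have hsum : ∑ y ∈ S, Γ.theta w y * (u s₀ y - m) + ∑ y ∈ S, Γ.theta w y * ((m + D) - u s₀ y) =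
        Γ.mass w (Γ.ball x₀ (l * r)) * D := by
      rw [← H.coe_finsetBall, mass_eq_sum, ← Finset.sum_add_distrib, Finset.sum_mul]
      exact Finset.sum_congr rfl fun y _ => by ring
    have hbig : c₃ * (l * r) ^ d * D ≤ Γ.mass w (Γ.ball x₀ (l * r)) * D :=
      mul_le_mul_of_nonneg_right hvol hD
    have hgain : η * D ≤ L * r ^ (-d) * (c₃ * (l * r) ^ d * D / 2) := by
      have h1 : r ^ (-d) * r ^ d = 1 := by rw [← Real.rpow_add hr0]; simp
      have h2 : L * r ^ (-d) * (c₃ * (l * r) ^ d * D / 2) = L * c₃ * l ^ d / 2 * D := by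
        rw [Real.mul_rpow hl.le hr0.le]
        linear_combination (L * c₃ * l ^ d / 2 * D) * h1
      rw [h2]
      exact mul_le_mul_of_nonneg_right (min_le_left _ _) hD
    have hLr : 0 < L * r ^ (-d) := by positivity
    have hsub : ∀ t ∈ Icc (τ - 4 * (l * r) ^ 2) τ, ∀ x ∈ Γ.ball x₀ (l * r),
        m ≤ u t x ∧ u t x ≤ m + D := fun t ht x hx => by
      refine hm t ⟨?_, ht.2⟩ x (ball_mono x₀ (by linarith) hx)
      have := ht.1
      rw [mul_pow] at this
      nlinarith
    rcases le_total (∑ y ∈ S, Γ.theta w y * ((m + D) - u s₀ y))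
      (∑ y ∈ S, Γ.theta w y * (u s₀ y - m)) with h | h
    · refine ⟨m + η * D, fun t ht x hx => ⟨?_, by linarith [(hsub t ht x hx).2]⟩⟩
      have h1 := hlow1 t ht x hx
      have h2 := mul_le_mul_of_nonneg_left (show c₃ * (l * r) ^ d * D / 2 ≤
        ∑ y ∈ S, Γ.theta w y * (u s₀ y - m) by linarith) hLr.le
      linarith
    · refine ⟨m, fun t ht x hx => ⟨(hsub t ht x hx).1, ?_⟩⟩
      have h1 := hlow2 t ht x hx
      have h2 := mul_le_mul_of_nonneg_left (show c₃ * (l * r) ^ d * D / 2 ≤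
        ∑ y ∈ S, Γ.theta w y * ((m + D) - u s₀ y) by linarith) hLr.le
      linarith
  have hhalfr : Tendsto (fun r : ℝ => r / 2) atTop atTop := tendsto_id.atTop_div_const two_pos
  filter_upwards [hhalfr.eventually hev] with r hr τ D u hτ
  have h1 : 2 * (r / 2) = r := by ring
  have h2 : l * (r / 2) = l / 2 * r := by ring
  have h3 := hr τ D u (by linarith)
  rwa [h1, h2] at h3

theorem bddAbove_upperCylinder {V : Type*} {Γ : WeightedGraph V} {w : WalkType} {C R T : ℝ} {x : V}
    {u : ℝ → V → ℝ} (hball : (Γ.ball x R).Finite) (hT : 0 < T) (hR : 0 ≤ R) (hC : 1 ≤ C)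
    (hu : Γ.IsCaloric w C x R T u) :
    BddAbove ((fun p : ℝ × V => u p.1 p.2) '' Γ.upperCylinder x R T) := by
  have h1 : BddAbove (⋃ y ∈ Γ.ball x R, (fun s => u s y) '' Icc (3 * T) (4 * T)) := by
    refine (hball.bddAbove_biUnion).2 fun y hy => ?_
    refine isCompact_Icc.bddAbove_image ((hu.continuousOn y ?_).mono fun s hs => ?_)
    · exact ball_mono x (by nlinarith) hy
    · exact ⟨by linarith [hs.1], hs.2⟩
  refine h1.mono ?_
  rintro _ ⟨⟨s, y⟩, ⟨hs, hy⟩, rfl⟩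
  exact mem_biUnion hy ⟨s, hs, rfl⟩

end WeightedGraph

end

open WeightedGraph in
theorem corollary1p6 (w : WalkType) (d : ℝ) (hd : 0 < d) (M : ℕ) (K : WalkConstants) :
    ∃ c : ℝ, 0 < c ∧ ∃ β : ℝ, 0 < β ∧ ∃ C : ℝ, 2 ≤ C ∧
      ∀ (V : Type*) [Countable V] [MeasurableSpace V] [DiscreteMeasurableSpace V]
        (Γ : WeightedGraph V) (x₀ : V),
        Γ.IsConnected → Γ.DegreeLE M → Γ.StandingAssumption w d K x₀ →
        ∃ R₆ : ℝ, 1 ≤ R₆ ∧ ∀ R T' : ℝ, R₆ ≤ R → R ^ 2 + 1 ≤ T' →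
          ∀ u : ℝ → V → ℝ,
            (∀ p ∈ Γ.cylinder C x₀ (Real.sqrt T') T', 0 ≤ u p.1 p.2) →
            Γ.IsCaloric w C x₀ (Real.sqrt T') T' u →
            ∀ x₁ ∈ Γ.ball x₀ R, ∀ x₂ ∈ Γ.ball x₀ R,
            ∀ t₁ ∈ Set.Icc (4 * (T' - R ^ 2)) (4 * T'),
            ∀ t₂ ∈ Set.Icc (4 * (T' - R ^ 2)) (4 * T'),
              3 * T' ≤ t₁ → 3 * T' ≤ t₂ →
              |u t₁ x₁ - u t₂ x₂| ≤ c * (R / Real.sqrt T') ^ β *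
                sSup ((fun p : ℝ × V => u p.1 p.2) '' Γ.upperCylinder x₀ (Real.sqrt T') T') := by
  obtain ⟨μ, η, hμ0, hμ1, hη0, hη1, hosc⟩ := exists_caloric_oscillation hd K.c₁_pos K.c₃_pos
    K.c₄_pos (exitConst_pos w K) (le_max_left 1 K.C_E)
  have hlogμ : Real.log μ < 0 := Real.log_neg hμ0 hμ1
  have hlogη : Real.log (1 - η) < 0 := Real.log_neg (by linarith) (by linarith)
  set β := Real.log (1 - η) / Real.log μ with hβ
  have hβ0 : 0 < β := div_pos_of_neg_of_neg hlogη hlogμ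
  have hμβ : μ ^ β = 1 - η := by
    rw [Real.rpow_def_of_pos hμ0, hβ, mul_div_cancel₀ _ hlogμ.ne, Real.exp_log (by linarith)]
  refine ⟨(2 / μ) ^ β, by positivity, β, hβ0, 2, le_rfl, fun V _ _ _ Γ x₀ hconn hdeg hass => ?_⟩
  have H := hass.scaleEstimates hd hconn hdeg
  obtain ⟨ρ, hρ⟩ := Filter.eventually_atTop.1 (hosc H)
  refine ⟨max 1 ρ, le_max_left _ _, fun R T' hR hT u hu0 hu => ?_⟩
  have hR1 : 1 ≤ R := (le_max_left _ _).trans hR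
  have hRρ : ρ ≤ R := (le_max_right _ _).trans hR
  have hT0 : 0 < T' := by nlinarith
  set q := √T' with hq
  have hq0 : 0 < q := Real.sqrt_pos.2 hT0
  have hqT : q ^ 2 = T' := Real.sq_sqrt hT0.le
  have hRq : R < q := Real.lt_sqrt_of_sq_lt (by linarith)
  set S := sSup ((fun p : ℝ × V => u p.1 p.2) '' Γ.upperCylinder x₀ q T') with hS
  have hbdd := bddAbove_upperCylinder (finite_ball hconn hdeg.finite_neighbors x₀ q) hT0 hq0.le
    one_le_two hu
  have hbound : ∀ s ∈ Icc (3 * T') (4 * T'), ∀ x ∈ Γ.ball x₀ q, 0 ≤ u s x ∧ u s x ≤ S := by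
    intro s hs x hx
    refine ⟨hu0 (s, x) ⟨⟨by linarith [hs.1], hs.2⟩, ball_mono x₀ (by linarith) hx⟩, ?_⟩
    exact le_csSup hbdd ⟨(s, x), ⟨hs, hx⟩, rfl⟩
  have hS0 : 0 ≤ S := by
    have := hbound (4 * T') ⟨by linarith, le_rfl⟩ x₀ (mem_ball_self x₀ hq0)
    linarith
  have hcβ : (2 / μ) ^ β * (R / q) ^ β = (2 / μ * (R / q)) ^ β :=
    (Real.mul_rpow (by positivity) (by positivity)).symm
  rw [hcβ]
  intro x₁ hx₁ x₂ hx₂ t₁ ht₁ t₂ ht₂ ht₁' ht₂'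
  rcases lt_or_ge (q / 2) R with hcase | hcase
  · have h1 := hbound t₁ ⟨ht₁', ht₁.2⟩ x₁ (ball_mono x₀ hRq.le hx₁)
    have h2 := hbound t₂ ⟨ht₂', ht₂.2⟩ x₂ (ball_mono x₀ hRq.le hx₂)
    have h3 : 1 ≤ 2 / μ * (R / q) := by
      rw [div_mul_div_comm, le_div_iff₀ (by positivity)]
      nlinarith
    have h4 : S ≤ (2 / μ * (R / q)) ^ β * S :=
      le_mul_of_one_le_left hS0 (Real.one_le_rpow h3 hβ0.le)
    exact (abs_le.2 ⟨by linarith, by linarith⟩).trans h4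
  · obtain ⟨n, hn1, hn2⟩ := exists_nat_pow_near_of_lt_one (x := R / (q / 2)) (y := μ)
      (by positivity) ((div_le_one (by positivity)).2 hcase) hμ0 hμ1
    rw [lt_div_iff₀ (by positivity)] at hn1
    rw [div_le_iff₀ (by positivity)] at hn2
    have hiter : ∀ i ≤ n, Γ.CylinderOscLE x₀ u (4 * T') (μ ^ i * (q / 2)) ((1 - η) ^ i * S) := by
      intro i
      induction i with
      | zero =>
        intro _
        refine ⟨0, fun s hs x hx => ?_⟩
        simp only [pow_zero, one_mul, zero_add] at hs hx ⊢
        refine hbound s ⟨?_, hs.2⟩ x (ball_mono x₀ (by linarith) hx)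
        have := hs.1
        nlinarith
      | succ i ih =>
        intro hi
        have hpow : μ ^ n ≤ μ ^ i := pow_le_pow_of_le_one hμ0.le hμ1.le (by omega)
        have hpow1 : μ ^ i ≤ 1 := pow_le_one₀ hμ0.le hμ1.le
        have hle : R ≤ μ ^ i * (q / 2) := hn2.trans (by gcongr)
        have hle2 : μ ^ i * (q / 2) ≤ q / 2 := mul_le_of_le_one_left (by positivity) hpow1
        have hb : Γ.ball x₀ (μ ^ i * (q / 2)) ⊆ Γ.ball x₀ (2 * q) := ball_mono x₀ (by linarith)
        have h := hρ (μ ^ i * (q / 2)) (hRρ.trans hle) (4 * T') _ u (by nlinarith)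
          (fun t ht y hy => hu.hasDerivAt t ht y (hb hy))
          (fun y hy => hu.continuousOn y (hb hy)) (ih (by omega))
        rwa [← mul_assoc, ← mul_assoc, ← pow_succ', ← pow_succ'] at h
    obtain ⟨m, hm⟩ := hiter n le_rfl
    have hsub : ∀ t, t ∈ Icc (4 * (T' - R ^ 2)) (4 * T') →
        t ∈ Icc (4 * T' - 4 * (μ ^ n * (q / 2)) ^ 2) (4 * T') := fun t ht =>
      ⟨by nlinarith [ht.1], ht.2⟩
    have h1 := hm t₁ (hsub t₁ ht₁) x₁ (ball_mono x₀ hn2 hx₁)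
    have h2 := hm t₂ (hsub t₂ ht₂) x₂ (ball_mono x₀ hn2 hx₂)
    have h3 : (1 - η) ^ n ≤ (2 / μ * (R / q)) ^ β := by
      rw [← hμβ, ← Real.rpow_natCast, ← Real.rpow_mul hμ0.le, mul_comm β, Real.rpow_mul hμ0.le,
        Real.rpow_natCast]
      refine Real.rpow_le_rpow (by positivity) ?_ hβ0.le
      rw [div_mul_div_comm, le_div_iff₀ (by positivity)]
      rw [pow_succ] at hn1
      nlinarith
    exact (abs_le.2 ⟨by linarith, by linarith⟩).trans (mul_le_mul_of_nonneg_right h3 hS0)
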